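/- Let $p$ be a prime number and let $K$ be an ultrametric extension of $\mathbf{Q}_p$, i.e. a field extension with an absolute value extending the $p$-adic one ($K$ need not be complete). Let $A\in K[T]$ be a nonzero polynomial, let $P(T)=\sum_{i=1}^{D}a_iT^i$ be its primitive without constant term, and let $D\ge 1$ be the degree of $P$. For $1\le n\le D$ put $d_n=\lfloor\log_p(D/n)\rfloor$, and put $d=d_1$. Let $L$ be an extension of $K$, with an absolute value extending that of $K$, that contains a root of unity $\zeta$ of order $p^{d+1}$, and put $\zeta_{d-i}=\zeta^{p^i}$ for $0\le i\le d$. Set $$\widetilde P(T)=\sum_{n=1}^{D}\frac{a_n}{\zeta_{d_n}-1}T^n\in L[T],$$ and let $\widetilde e(T)=1+\sum_{i=1}^{D}\widetilde a_iT^i\in L[T]$ be the polynomial obtained from the formal series $\exp(\widetilde P(T))$ by keeping only the terms of degree at most $D$. Let $y\in K[[T]]$ be a nonzero formal solution at the origin of $y'=A\,y$, and let $\rho$ be its radius of convergence, $1/\rho=\limsup_{i}|y_i|^{1/i}$ for $y=\sum_i y_iT^i$. Then $0<\rho<\infty$, and: 1. $\log\rho$ is the end of the first segment, of slope zero, of the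 dual Newton polygon of $\widetilde e$, that is, of the function $\log r\mapsto\log\max_{0\le i\le D}|\widetilde a_i|r^i$ (with $\widetilde a_0=1$): $(-\infty,\log\rho]$ is the largest half-line unbounded to the left on which this function is affine of slope $0$. 2. $\rho$ is the smallest absolute value of a root of $\widetilde e$: for every extension $\Omega$ of $L$, with an absolute value extending that of $L$, over which $\widetilde e$ splits into linear factors (for instance an algebraic closure of $L$), $\rho$ is the minimum of $|x|$ over the roots $x\in\Omega$ of $\widetilde e$. 3. With $\log 0=-\infty$, $$-\log\rho=\max_{1\le i\le D}\frac1i\log|\widetilde a_i|.$$ -/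

import Mathlib

open Polynomial PowerSeries
open scoped ENNReal

noncomputable section

/-- The primitive `P` without constant term of a polynomial `A` (over a field of
characteristic zero). -/
def zeroPrimitive {F : Type*} [Field F] (A : F[X]) : F[X] :=
  ∑ n ∈ A.support, Polynomial.monomial (n + 1) (A.coeff n / ((n : F) + 1))

/-- `y` is a formal solution at the origin of the differential equation `y' = A y`. -/
def IsFormalSolution {F : Type*} [Field F] (A : F[X]) (y : F⟦X⟧) : Prop :=
  PowerSeries.derivative F y = (A : F⟦X⟧) * y

/-- The radius of convergence, through Cauchy and Hadamard's formula
`1 / ρ = limsup |b_i| ^ (1 / i)`, with values in `[0, ∞]`. -/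
def convergenceRadius {F : Type*} [NormedField F] (f : F⟦X⟧) : ℝ≥0∞ :=
  (Filter.limsup (fun i : ℕ => ‖PowerSeries.coeff i f‖ₑ ^ (1 / (i : ℝ))) Filter.atTop)⁻¹

/-- The integer part of `log_p (D / n)`, i.e. the largest `d` with `n * p ^ d ≤ D`
(for `1 ≤ n ≤ D`). -/
def floorLog (p D n : ℕ) : ℕ := Nat.log p (D / n)

/-- For `P = a_1 T + ... + a_D T ^ D` of degree `D`, and `ζ` a root of unity of order `p ^ (d + 1)`
with `d = floorLog p D 1`, the polynomial `∑ a_n / (ζ_{d_n} - 1) T ^ n`, where `d_n = floorLog p D n`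
and where `ζ_{d - i} = ζ ^ (p ^ i)` has order `p ^ (d - i + 1)`. -/
def tildeP {K L : Type*} [Field K] [Field L] [Algebra K L] (p : ℕ) (ζ : L) (P : K[X]) : L[X] :=
  ∑ n ∈ Finset.Icc 1 P.natDegree,
    Polynomial.monomial n (algebraMap K L (P.coeff n) /
      (ζ ^ p ^ (floorLog p P.natDegree 1 - floorLog p P.natDegree n) - 1))

/-- The formal exponential `exp (f)` of a power series `f` without constant term. -/
def formalExp {F : Type*} [Field F] [CharZero F] (f : F⟦X⟧) : F⟦X⟧ :=
  (PowerSeries.exp F).subst f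

/-- The polynomial obtained from the series `exp (tildeP)` by keeping only the terms
of degree at most `D = deg P`. -/
def tildeE {K L : Type*} [Field K] [Field L] [CharZero L] [Algebra K L]
    (p : ℕ) (ζ : L) (P : K[X]) : L[X] :=
  PowerSeries.trunc (P.natDegree + 1) (formalExp (tildeP p ζ P : L⟦X⟧))

/-- The dual Newton polygon of a polynomial `Q = ∑ q_i T ^ i`: the function sending `s = log r`
to the logarithm of the Gauss norm `max |q_i| r ^ i` of `Q` at the radius `r`. -/
def dualNewtonPolygon {F : Type*} [NormedField F] (Q : F[X]) (s : ℝ) : ℝ :=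
  Real.log (Q.gaussNorm (NormedField.toAbsoluteValue F) (Real.exp s))

/-- The first segment of the graph of `f`, the one coming from `-∞`, has slope `m` and ends at the
abscissa `t`: the half-line `(-∞, t]` is the largest one on which `f` is affine of slope `m`. -/
def IsEndOfFirstSegment (f : ℝ → ℝ) (m t : ℝ) : Prop :=
  IsGreatest {u : ℝ | ∀ s ≤ u, f s = f u + m * (s - u)} t

end

/-! Let `ℓ = ∑ T^(p^k)/p^k`. The Artin-Hasse series `E = exp ℓ` has integral coefficients. Let
`λ_n`, `1 ≤ n ≤ D`, be the coordinates for which `P̃` agrees with `∑ ℓ(λ_n T^n)` up to degree `D`,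
so that `ẽ` agrees with `∏ E(λ_n T^n)` up to that degree (`coeff_tildeE`). Raising `ζ_{d_n}` to the
power `p^k` gives `ζ_{d_N}` with `N = n p^k` as long as `N ≤ D`, and `1` afterwards. Because of
this, the denominators in `P̃` make `P` exactly equal to `∑ (ℓ(ζ_{d_n} λ_n T^n) - ℓ(λ_n T^n))`
(`map_eq_sum_levelTerm`), and `exp P` is the product of the quotients `E(ζ_{d_n} λ_n T^n) / E(λ_n
T^n)`.

Both `ẽ` and `exp P` are therefore governed by the radius `ρ` at which `max |λ_n| ρ^n = 1`.
Integrality of `E` bounds both by `1` at `ρ`. For `ẽ` the bound is attained in positive degree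
(`exists_norm_coeff_tildeE_eq`), and the three descriptions of `ρ` follow by elementary Newton
polygon arguments.

It remains to see that `exp P` is unbounded on every larger disc. The factors with `|λ_n| ρ^n < 1`,
and their inverses, stay bounded slightly beyond `ρ` and can be divided out. For the remaining sum
`Q` (`not_coeffBound_formalExp_sum_levelTerm`), let `n₀` be its least index and `d = d_{n₀}`, and
suppose `exp Q` were bounded beyond `ρ`. At a radius `ρt` with `t > 1` close to `1`, the Gauss norm
of `exp(p^(d+1) Q) - 1` is then estimated twice, with `w = p^(-1/(p-1))`. The `p`-th power map,
iterated from `exp Q - 1`, gives at least `p⁻¹ w t^(n₀ p^(d+1))`. The size of `p^(d+1) Q` gives at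
most `p⁻¹ w t^D`. Since `n₀ p^(d+1) > D`, this is absurd. -/

/-! ### Gauss norms of power series and dominant coefficients -/

section CoeffBound

variable {F : Type*} [NormedField F]

/-- The coefficients of `f` satisfy `‖f_i‖ r ^ i ≤ C`. -/
def CoeffBound (r C : ℝ) (f : F⟦X⟧) : Prop := ∀ i, ‖PowerSeries.coeff i f‖ * r ^ i ≤ C

/-- `i` is the least index at which `‖f_i‖ r ^ i` attains its maximum, and this maximum is `c`. -/
def Dominates (r c : ℝ) (i : ℕ) (f : F⟦X⟧) : Prop :=
  ‖PowerSeries.coeff i f‖ * r ^ i = c ∧ (∀ j < i, ‖PowerSeries.coeff j f‖ * r ^ j < c) ∧ CoeffBound r c f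

lemma CoeffBound.mono {r C C' : ℝ} {f : F⟦X⟧} (hf : CoeffBound r C f) (h : C ≤ C') :
    CoeffBound r C' f := fun i => (hf i).trans h

lemma CoeffBound.mono_radius {r r' C : ℝ} (hr : 0 ≤ r) (h : r ≤ r') {f : F⟦X⟧}
    (hf : CoeffBound r' C f) : CoeffBound r C f := fun i =>
  (mul_le_mul_of_nonneg_left (pow_le_pow_left₀ hr h i) (norm_nonneg _)).trans (hf i)

lemma coeffBound_one {r : ℝ} : CoeffBound r 1 (1 : F⟦X⟧) := by
  intro i
  rw [PowerSeries.coeff_one]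
  split_ifs with h
  · simp [h]
  · simp

lemma CoeffBound.neg {r C : ℝ} {f : F⟦X⟧} (hf : CoeffBound r C f) : CoeffBound r C (-f) := by
  intro i
  rw [map_neg, norm_neg]
  exact hf i

lemma norm_mul_mul_pow {a b : F} {r : ℝ} {i j k : ℕ} (h : i + j = k) :
    ‖a * b‖ * r ^ k = ‖a‖ * r ^ i * (‖b‖ * r ^ j) := by
  rw [← h, norm_mul, pow_add]
  ring

lemma dominates_one {r : ℝ} : Dominates r 1 0 (1 : F⟦X⟧) :=
  ⟨by simp, fun j hj => absurd hj (Nat.not_lt_zero j), coeffBound_one⟩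

/-- A nonzero series that is bounded on a larger disc has a dominant coefficient. -/
lemma CoeffBound.exists_dominates {r r' C : ℝ} (hr : 0 < r) (hrr' : r < r') {f : F⟦X⟧}
    (hf : CoeffBound r' C f) {n : ℕ} (hn : PowerSeries.coeff n f ≠ 0) :
    ∃ i c, Dominates r c i f ∧ ‖PowerSeries.coeff n f‖ * r ^ n ≤ c := by
  classical
  set u : ℕ → ℝ := fun i => ‖PowerSeries.coeff i f‖ * r ^ i with hu
  have hun : 0 < u n := mul_pos (norm_pos_iff.2 hn) (by positivity)
  have hle : ∀ i, u i ≤ C * (r / r') ^ i := fun i => by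
    have h0 : 0 < r' := hr.trans hrr'
    have : u i = ‖PowerSeries.coeff i f‖ * r' ^ i * (r / r') ^ i := by
      simp only [hu, div_pow]
      field_simp
    rw [this]
    exact mul_le_mul_of_nonneg_right (hf i) (by positivity)
  have hlim : Filter.Tendsto u Filter.atTop (nhds 0) := by
    have h0 : 0 < r' := hr.trans hrr'
    have := (tendsto_pow_atTop_nhds_zero_of_lt_one (r := r / r') (by positivity)
      ((div_lt_one h0).2 hrr')).const_mul C
    rw [mul_zero] at this
    exact squeeze_zero (fun i => by positivity) hle this
  obtain ⟨N, hN⟩ := Filter.eventually_atTop.1 (hlim.eventually_lt_const hun)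
  -- Past `N` every term is below `u n`, so a maximum over a finite range containing `n` is global.
  obtain ⟨m, hm, hmax⟩ := (Finset.range (max N n + 1)).exists_max_image u ⟨n, by simp⟩
  have hmax' : ∀ i, u i ≤ u m := by
    intro i
    by_cases hi : i < max N n + 1
    · exact hmax i (Finset.mem_range.2 hi)
    · exact (hN i (by omega)).le.trans (hmax n (by simp))
  have hex : ∃ i, ∀ j, u j ≤ u i := ⟨m, hmax'⟩
  refine ⟨Nat.find hex, u (Nat.find hex), ⟨rfl, fun j hj => ?_, Nat.find_spec hex⟩,
    Nat.find_spec hex n⟩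
  have := Nat.find_min hex hj
  push Not at this
  obtain ⟨k, hk⟩ := this
  exact hk.trans_le (Nat.find_spec hex k)

variable [IsUltrametricDist F]

lemma norm_sum_mul_pow_le {ι : Type*} {s : Finset ι} {u : ι → F} {t C : ℝ} (ht : 0 ≤ t)
    (hC : 0 ≤ C) (h : ∀ i ∈ s, ‖u i‖ * t ≤ C) : ‖∑ i ∈ s, u i‖ * t ≤ C := by
  rcases ht.eq_or_lt with rfl | ht
  · simpa using hC
  · rw [← le_div_iff₀ ht]
    refine IsUltrametricDist.norm_sum_le_of_forall_le_of_nonneg (by positivity) fun i hi => ?_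
    rw [le_div_iff₀ ht]
    exact h i hi

lemma norm_sum_mul_pow_lt {ι : Type*} {s : Finset ι} {u : ι → F} {t C : ℝ} (ht : 0 ≤ t)
    (hC : 0 < C) (h : ∀ i ∈ s, ‖u i‖ * t < C) : ‖∑ i ∈ s, u i‖ * t < C := by
  rcases s.eq_empty_or_nonempty with rfl | hs
  · simpa using hC
  · obtain ⟨i, hi, hmax⟩ := s.exists_max_image (fun i => ‖u i‖) hs
    refine lt_of_le_of_lt ?_ (h i hi)
    exact mul_le_mul_of_nonneg_right
      (IsUltrametricDist.norm_sum_le_of_forall_le_of_nonneg (norm_nonneg _) hmax) ht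

lemma CoeffBound.sum {ι : Type*} {s : Finset ι} {f : ι → F⟦X⟧} {r C : ℝ} (hr : 0 ≤ r)
    (hC : 0 ≤ C) (h : ∀ i ∈ s, CoeffBound r C (f i)) : CoeffBound r C (∑ i ∈ s, f i) := by
  intro k
  rw [map_sum]
  exact norm_sum_mul_pow_le (by positivity) hC fun i hi => h i hi k

lemma CoeffBound.add {r C : ℝ} (hr : 0 ≤ r) {f g : F⟦X⟧} (hf : CoeffBound r C f)
    (hg : CoeffBound r C g) : CoeffBound r C (f + g) := by
  intro k
  rw [map_add]
  refine (mul_le_mul_of_nonneg_right (IsUltrametricDist.norm_add_le_max _ _)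
    (by positivity)).trans ?_
  rw [max_mul_of_nonneg _ _ (by positivity)]
  exact max_le (hf k) (hg k)

lemma CoeffBound.sub {r C : ℝ} (hr : 0 ≤ r) {f g : F⟦X⟧} (hf : CoeffBound r C f)
    (hg : CoeffBound r C g) : CoeffBound r C (f - g) := by
  rw [sub_eq_add_neg]
  exact hf.add hr hg.neg

lemma CoeffBound.mul {r C C' : ℝ} (hr : 0 ≤ r) (hC : 0 ≤ C) (hC' : 0 ≤ C') {f g : F⟦X⟧}
    (hf : CoeffBound r C f) (hg : CoeffBound r C' g) : CoeffBound r (C * C') (f * g) := by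
  intro k
  rw [PowerSeries.coeff_mul]
  refine norm_sum_mul_pow_le (by positivity) (by positivity) fun x hx => ?_
  rw [norm_mul_mul_pow (Finset.HasAntidiagonal.mem_antidiagonal.1 hx)]
  exact mul_le_mul (hf _) (hg _) (by positivity) hC

lemma CoeffBound.pow {r C : ℝ} (hr : 0 ≤ r) (hC : 0 ≤ C) {f : F⟦X⟧}
    (hf : CoeffBound r C f) (n : ℕ) : CoeffBound r (C ^ n) (f ^ n) := by
  induction n with
  | zero => simpa using coeffBound_one
  | succ n ih =>
    rw [pow_succ, pow_succ]
    exact ih.mul hr (by positivity) hC hf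

lemma CoeffBound.prod {ι : Type*} {s : Finset ι} {f : ι → F⟦X⟧} {r : ℝ} (hr : 0 ≤ r)
    (h : ∀ i ∈ s, CoeffBound r 1 (f i)) : CoeffBound r 1 (∏ i ∈ s, f i) := by
  classical
  induction s using Finset.induction_on with
  | empty => simpa using coeffBound_one
  | insert a s ha ih =>
    rw [Finset.prod_insert ha]
    simpa using (h a (by simp)).mul hr zero_le_one zero_le_one
      (ih fun i hi => h i (Finset.mem_insert_of_mem hi))

/-- The inverse of a series with constant term `1` satisfying `‖f_i‖ r ^ i ≤ 1` satisfies the same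
bound. -/
lemma CoeffBound.of_mul_eq_one {r : ℝ} (hr : 0 ≤ r) {f g : F⟦X⟧} (hf : CoeffBound r 1 f)
    (hf0 : PowerSeries.coeff 0 f = 1) (hfg : f * g = 1) : CoeffBound r 1 g := by
  intro k
  induction k using Nat.strong_induction_on with
  | _ k ih =>
    rcases Nat.eq_zero_or_pos k with rfl | hk
    · have := congrArg (PowerSeries.coeff 0) hfg
      rw [coeff_zero_eq_constantCoeff_apply] at hf0
      rw [coeff_zero_eq_constantCoeff_apply, map_mul, hf0, one_mul, coeff_zero_one] at this
      simp [this]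
    · have h := congrArg (PowerSeries.coeff k) hfg
      rw [PowerSeries.coeff_one, if_neg hk.ne', PowerSeries.coeff_mul] at h
      have hmem : ((0, k) : ℕ × ℕ) ∈ Finset.HasAntidiagonal.antidiagonal k := by simp
      rw [← Finset.add_sum_erase _ _ hmem] at h
      simp only [hf0, one_mul] at h
      rw [eq_neg_of_add_eq_zero_left h, norm_neg]
      refine norm_sum_mul_pow_le (by positivity) zero_le_one fun x hx => ?_
      rw [Finset.mem_erase, Finset.HasAntidiagonal.mem_antidiagonal] at hx
      rw [norm_mul_mul_pow hx.2]
      have hx1 : x.2 < k := by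
        rcases Nat.eq_zero_or_pos x.1 with h0 | h0
        · exact absurd (Prod.ext h0 (by omega)) hx.1
        · omega
      exact mul_le_one₀ (hf _) (by positivity) (ih _ hx1)

lemma norm_add_eq_of_norm_lt {x y : F} (h : ‖y‖ < ‖x‖) : ‖x + y‖ = ‖x‖ := by
  rw [IsUltrametricDist.norm_add_eq_max_of_norm_ne_norm h.ne', max_eq_left h.le]

lemma Dominates.add {r c : ℝ} (hr : 0 < r) {i : ℕ} {f g : F⟦X⟧} (hf : Dominates r c i f)
    (hg : ∀ j, ‖PowerSeries.coeff j g‖ * r ^ j < c) : Dominates r c i (f + g) := by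
  refine ⟨?_, fun j hj => ?_, hf.2.2.add hr.le fun j => (hg j).le⟩
  · have h : ‖PowerSeries.coeff i g‖ < ‖PowerSeries.coeff i f‖ := by
      have := hg i
      rw [← hf.1] at this
      exact lt_of_mul_lt_mul_right this (by positivity)
    rw [map_add, norm_add_eq_of_norm_lt h, hf.1]
  · rw [map_add]
    refine (mul_le_mul_of_nonneg_right (IsUltrametricDist.norm_add_le_max _ _)
      (by positivity)).trans_lt ?_
    rw [max_mul_of_nonneg _ _ (by positivity)]
    exact max_lt (hf.2.1 j hj) (hg j)

/-- Gauss's lemma: in degree `i + j` any pair other than `(i, j)` has first index below `i` or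
second index below `j`, hence a strictly smaller contribution. This is why the least maximizing
index is recorded. -/
lemma Dominates.mul {r c c' : ℝ} (hr : 0 < r) (hc : 0 < c) (hc' : 0 < c') {i j : ℕ}
    {f g : F⟦X⟧} (hf : Dominates r c i f) (hg : Dominates r c' j g) :
    Dominates r (c * c') (i + j) (f * g) := by
  have key : ∀ a b, a < i ∨ b < j →
      ‖PowerSeries.coeff a f‖ * r ^ a * (‖PowerSeries.coeff b g‖ * r ^ b) < c * c' := by
    rintro a b (h | h)
    · exact mul_lt_mul_of_lt_of_le_of_nonneg_of_pos (hf.2.1 a h) (hg.2.2 b) (by positivity) hc'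
    · exact mul_lt_mul' (hf.2.2 a) (hg.2.1 b h) (by positivity) hc
  refine ⟨?_, fun k hk => ?_, hf.2.2.mul hr.le hc.le hc'.le hg.2.2⟩
  · have hmem : ((i, j) : ℕ × ℕ) ∈ Finset.HasAntidiagonal.antidiagonal (i + j) := by simp
    have h1 : ‖PowerSeries.coeff i f * PowerSeries.coeff j g‖ * r ^ (i + j) = c * c' := by
      rw [norm_mul_mul_pow rfl, hf.1, hg.1]
    rw [PowerSeries.coeff_mul, ← Finset.add_sum_erase _ _ hmem, norm_add_eq_of_norm_lt, h1]
    refine lt_of_mul_lt_mul_right (a := r ^ (i + j)) ?_ (by positivity)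
    rw [h1]
    refine norm_sum_mul_pow_lt (by positivity) (by positivity) fun x hx => ?_
    rw [Finset.mem_erase, Finset.HasAntidiagonal.mem_antidiagonal] at hx
    rw [norm_mul_mul_pow hx.2]
    refine key _ _ ?_
    by_contra! h
    exact hx.1 (Prod.ext (by simp; omega) (by simp; omega))
  · rw [PowerSeries.coeff_mul]
    refine norm_sum_mul_pow_lt (by positivity) (by positivity) fun x hx => ?_
    rw [Finset.HasAntidiagonal.mem_antidiagonal] at hx
    rw [norm_mul_mul_pow hx]
    exact key _ _ (by omega)

lemma Dominates.pow {r c : ℝ} (hr : 0 < r) (hc : 0 < c) {i : ℕ} {f : F⟦X⟧}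
    (hf : Dominates r c i f) (n : ℕ) : Dominates r (c ^ n) (n * i) (f ^ n) := by
  induction n with
  | zero => simpa using dominates_one
  | succ n ih =>
    rw [pow_succ, pow_succ, Nat.succ_mul]
    exact ih.mul hr (by positivity) hc hf

/-- If the Gauss norm `c` of `g` satisfies `c ^ (p - 1) > |p|`, then `(1 + g) ^ p - 1` has Gauss
norm `c ^ p`. -/
lemma Dominates.one_add_pow_prime {p : ℕ} (hp : p.Prime) (hpF : ‖(p : F)‖ = (p : ℝ)⁻¹)
    {r c : ℝ} (hr : 0 < r) (hc : 0 < c) (hcp : (p : ℝ)⁻¹ < c ^ (p - 1)) {i : ℕ} {g : F⟦X⟧}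
    (hg : Dominates r c i g) : Dominates r (c ^ p) (p * i) ((1 + g) ^ p - 1) := by
  obtain ⟨q, rfl⟩ : ∃ q, p = q + 1 := ⟨p - 1, by have := hp.pos; omega⟩
  have hexp : (1 + g) ^ (q + 1) - 1 = g ^ (q + 1) +
      ∑ m ∈ Finset.range q, g ^ (m + 1) * (((q + 1).choose (m + 1) : ℕ) : F⟦X⟧) := by
    rw [add_comm 1 g, add_pow, Finset.sum_range_succ, Finset.sum_range_succ']
    simp
    ring
  rw [hexp]
  refine (hg.pow hr hc (q + 1)).add hr fun j => ?_
  rw [map_sum]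
  refine norm_sum_mul_pow_lt (by positivity) (by positivity) fun m hm => ?_
  have hm := Finset.mem_range.1 hm
  have h1 := hg.2.2.pow hr.le hc.le (m + 1) j
  obtain ⟨t, ht⟩ := hp.dvd_choose_self (k := m + 1) (by omega) (by omega)
  have h2 : ‖(((q + 1).choose (m + 1) : ℕ) : F)‖ ≤ ((q + 1 : ℕ) : ℝ)⁻¹ := by
    rw [ht, Nat.cast_mul, norm_mul, hpF]
    exact mul_le_of_le_one_right (by positivity) (IsUltrametricDist.norm_natCast_le_one F t)
  have h3 : PowerSeries.coeff j (g ^ (m + 1) * (((q + 1).choose (m + 1) : ℕ) : F⟦X⟧)) =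
      PowerSeries.coeff j (g ^ (m + 1)) * (((q + 1).choose (m + 1) : ℕ) : F) := by
    rw [← map_natCast (PowerSeries.C (R := F)), PowerSeries.coeff_mul_C]
  rw [h3, norm_mul, mul_right_comm]
  refine (mul_le_mul h1 h2 (by positivity) (by positivity)).trans_lt ?_
  rw [show q + 1 - 1 = q by omega] at hcp
  -- The middle binomial terms are at most `c^(m+1) / p` with `m + 1 ≤ p - 1`. For `c ≥ 1` the
  -- factor `1/p` makes them smaller than `c^p`; for `c < 1` the hypothesis `1/p < c^(p-1)` does.
  by_cases hc1 : 1 ≤ c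
  · have h4 : c ^ (m + 1) ≤ c ^ (q + 1) := pow_le_pow_right₀ hc1 (by omega)
    have h5 : ((q + 1 : ℕ) : ℝ)⁻¹ < 1 := inv_lt_one_of_one_lt₀ (by exact_mod_cast hp.one_lt)
    calc c ^ (m + 1) * ((q + 1 : ℕ) : ℝ)⁻¹ < c ^ (m + 1) * 1 := by gcongr
      _ ≤ _ := by simpa using h4
  · calc c ^ (m + 1) * ((q + 1 : ℕ) : ℝ)⁻¹ < c ^ (m + 1) * c ^ q := by gcongr
      _ = c ^ (q + 1) * c ^ m := by ring
      _ ≤ c ^ (q + 1) := mul_le_of_le_one_right (by positivity)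
          (pow_le_one₀ hc.le (not_le.1 hc1).le)

lemma Dominates.one_add_pow_prime_pow {p : ℕ} (hp : p.Prime) (hpF : ‖(p : F)‖ = (p : ℝ)⁻¹)
    {r c : ℝ} (hr : 0 < r) (hc : 0 < c) {i : ℕ} {g : F⟦X⟧} (hg : Dominates r c i g) (k : ℕ)
    (hcp : ∀ j < k, (p : ℝ)⁻¹ < (c ^ p ^ j) ^ (p - 1)) :
    Dominates r (c ^ p ^ k) (p ^ k * i) ((1 + g) ^ p ^ k - 1) := by
  induction k with
  | zero => simpa using hg
  | succ k ih =>
    have h := (ih fun j hj => hcp j (by omega)).one_add_pow_prime hp hpF hr (by positivity)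
      (hcp k (by omega))
    rw [add_sub_cancel, ← pow_mul, ← pow_mul, ← mul_assoc, ← pow_succ, ← pow_succ'] at h
    exact h

end CoeffBound

/-! ### The formal exponential, characterized by its differential equation -/

section FormalExp

variable {F : Type*} [Field F] [CharZero F]

/-- Two solutions of `f' = Q f` and `g' = R g` with the same initial value agree up to degree `N`
if `Q` and `R` agree below degree `N`. -/
lemma coeff_eq_of_derivative_eq_mul {f g Q R : F⟦X⟧} (hf : d⁄dX F f = Q * f)
    (hg : d⁄dX F g = R * g) (h0 : constantCoeff f = constantCoeff g) {N : ℕ}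
    (hQR : ∀ i < N, PowerSeries.coeff i Q = PowerSeries.coeff i R) :
    ∀ i ≤ N, PowerSeries.coeff i f = PowerSeries.coeff i g := by
  intro i
  induction i using Nat.strong_induction_on with
  | _ i ih =>
    intro hi
    cases i with
    | zero => simpa using h0
    | succ i =>
      have h1 : PowerSeries.coeff i (d⁄dX F f) = PowerSeries.coeff i (d⁄dX F g) := by
        rw [hf, hg, PowerSeries.coeff_mul, PowerSeries.coeff_mul]
        refine Finset.sum_congr rfl fun x hx => ?_
        have hx := Finset.HasAntidiagonal.mem_antidiagonal.1 hx
        rw [hQR _ (by omega), ih x.2 (by omega) (by omega)]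
      rw [PowerSeries.coeff_derivative, PowerSeries.coeff_derivative] at h1
      exact mul_right_cancel₀ (by exact_mod_cast Nat.succ_ne_zero i) h1

lemma eq_of_derivative_eq_mul {f g Q : F⟦X⟧} (hf : d⁄dX F f = Q * f)
    (hg : d⁄dX F g = Q * g) (h0 : constantCoeff f = constantCoeff g) : f = g := by
  ext n
  exact coeff_eq_of_derivative_eq_mul (N := n) hf hg h0 (fun _ _ => rfl) n le_rfl

lemma derivative_formalExp {Q : F⟦X⟧} (hQ : constantCoeff Q = 0) :
    d⁄dX F (formalExp Q) = d⁄dX F Q * formalExp Q := by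
  rw [formalExp, derivative_subst (HasSubst.of_constantCoeff_zero' hQ), derivative_exp, mul_comm]

lemma constantCoeff_formalExp {Q : F⟦X⟧} (hQ : constantCoeff Q = 0) :
    constantCoeff (formalExp Q) = 1 := by
  rw [← coeff_zero_eq_constantCoeff_apply, formalExp,
    coeff_subst' (HasSubst.of_constantCoeff_zero' hQ), finsum_eq_single _ 0]
  · simp
  · intro n hn
    simp [hQ, hn]

lemma coeff_zero_formalExp {Q : F⟦X⟧} (hQ : constantCoeff Q = 0) :
    PowerSeries.coeff 0 (formalExp Q) = 1 := by
  rw [coeff_zero_eq_constantCoeff_apply, constantCoeff_formalExp hQ]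

lemma formalExp_zero : formalExp (0 : F⟦X⟧) = 1 :=
  eq_of_derivative_eq_mul (Q := 0) (by rw [derivative_formalExp (map_zero _), map_zero])
    (by simp) (by rw [constantCoeff_formalExp (map_zero _), map_one])

lemma formalExp_add {Q R : F⟦X⟧} (hQ : constantCoeff Q = 0) (hR : constantCoeff R = 0) :
    formalExp (Q + R) = formalExp Q * formalExp R := by
  have h : constantCoeff (Q + R) = 0 := by rw [map_add, hQ, hR, add_zero]
  refine eq_of_derivative_eq_mul (derivative_formalExp h) ?_ ?_
  · rw [Derivation.leibniz, derivative_formalExp hQ, derivative_formalExp hR, map_add,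
      smul_eq_mul, smul_eq_mul]
    ring
  · rw [map_mul, constantCoeff_formalExp h, constantCoeff_formalExp hQ,
      constantCoeff_formalExp hR, one_mul]

lemma formalExp_mul_neg {Q : F⟦X⟧} (hQ : constantCoeff Q = 0) :
    formalExp Q * formalExp (-Q) = 1 := by
  rw [← formalExp_add hQ (by rw [map_neg, hQ, neg_zero]), add_neg_cancel, formalExp_zero]

lemma formalExp_sum {ι : Type*} {s : Finset ι} {Q : ι → F⟦X⟧}
    (hQ : ∀ i ∈ s, constantCoeff (Q i) = 0) :
    formalExp (∑ i ∈ s, Q i) = ∏ i ∈ s, formalExp (Q i) := by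
  classical
  induction s using Finset.induction_on with
  | empty => simpa using formalExp_zero
  | insert a s ha ih =>
    have h' : ∀ i ∈ s, constantCoeff (Q i) = 0 := fun i hi => hQ i (Finset.mem_insert_of_mem hi)
    rw [Finset.sum_insert ha, Finset.prod_insert ha, formalExp_add (hQ a (by simp)), ih h']
    rw [map_sum]
    exact Finset.sum_eq_zero h'

lemma formalExp_natCast_mul {Q : F⟦X⟧} (hQ : constantCoeff Q = 0) (n : ℕ) :
    formalExp ((n : F⟦X⟧) * Q) = formalExp Q ^ n := by
  have := formalExp_sum (s := Finset.range n) (Q := fun _ => Q) fun _ _ => hQ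
  simpa using this

/-- Exponentials of series that agree up to degree `N` agree up to degree `N`. -/
lemma coeff_formalExp_congr {Q R : F⟦X⟧} (hQ : constantCoeff Q = 0) (hR : constantCoeff R = 0)
    {N : ℕ} (h : ∀ i ≤ N, PowerSeries.coeff i Q = PowerSeries.coeff i R) :
    ∀ i ≤ N, PowerSeries.coeff i (formalExp Q) = PowerSeries.coeff i (formalExp R) := by
  refine coeff_eq_of_derivative_eq_mul (derivative_formalExp hQ) (derivative_formalExp hR) ?_ ?_
  · rw [constantCoeff_formalExp hQ, constantCoeff_formalExp hR]
  · intro i hi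
    rw [PowerSeries.coeff_derivative, PowerSeries.coeff_derivative, h (i + 1) (by omega)]

/-- The first nonzero coefficients of `Q` and of `exp Q - 1` agree. -/
lemma coeff_formalExp_of_coeff_eq_zero {Q : F⟦X⟧} {n : ℕ} (hn : n ≠ 0)
    (hQ : ∀ i < n, PowerSeries.coeff i Q = 0) :
    PowerSeries.coeff n (formalExp Q) = PowerSeries.coeff n Q := by
  have hQ0 : constantCoeff Q = 0 := by
    rw [← coeff_zero_eq_constantCoeff_apply, hQ 0 (by omega)]
  obtain ⟨m, rfl⟩ : ∃ m, n = m + 1 := ⟨n - 1, by omega⟩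
  have h := congrArg (PowerSeries.coeff m) (derivative_formalExp hQ0)
  rw [PowerSeries.coeff_mul, Finset.sum_eq_single (m, 0), PowerSeries.coeff_derivative,
    PowerSeries.coeff_derivative, coeff_zero_formalExp hQ0, mul_one] at h
  · exact mul_right_cancel₀ (by exact_mod_cast Nat.succ_ne_zero m) h
  · intro x hx hne
    have hx := Finset.HasAntidiagonal.mem_antidiagonal.1 hx
    have : x.1 < m := by
      by_contra hlt
      exact hne (Prod.ext (by simp; omega) (by simp; omega))
    rw [PowerSeries.coeff_derivative, hQ _ (by omega), zero_mul, zero_mul]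
  · simp

lemma formalExp_subst {Q b : F⟦X⟧} (hQ : constantCoeff Q = 0) (hb : constantCoeff b = 0) :
    (formalExp Q).subst b = formalExp (Q.subst b) :=
  subst_comp_subst_apply (HasSubst.of_constantCoeff_zero' hQ)
    (HasSubst.of_constantCoeff_zero' hb) _

lemma derivative_powerSeries_map {R S : Type*} [CommRing R] [CommRing S] (φ : R →+* S) (f : R⟦X⟧) :
    d⁄dX S (f.map φ) = (d⁄dX R f).map φ := by
  ext n
  simp [PowerSeries.coeff_derivative]

lemma formalExp_map {E : Type*} [Field E] [CharZero E] (φ : F →+* E) {Q : F⟦X⟧}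
    (hQ : constantCoeff Q = 0) : formalExp (Q.map φ) = (formalExp Q).map φ := by
  have hQ' : constantCoeff (Q.map φ) = 0 := by
    rw [← coeff_zero_eq_constantCoeff_apply, PowerSeries.coeff_map,
      coeff_zero_eq_constantCoeff_apply, hQ, map_zero]
  refine eq_of_derivative_eq_mul (derivative_formalExp hQ') ?_ ?_
  · rw [derivative_powerSeries_map, derivative_powerSeries_map, derivative_formalExp hQ, map_mul]
  · rw [constantCoeff_formalExp hQ', ← coeff_zero_eq_constantCoeff_apply, PowerSeries.coeff_map,
      coeff_zero_formalExp hQ, map_one]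

end FormalExp

/-! ### Norms of integers and factorials, convergence of the exponential -/

section Norms

lemma norm_natCast_eq_padic (p : ℕ) [Fact p.Prime] {L : Type*} [NormedField L]
    [NormedAlgebra ℚ_[p] L] (n : ℕ) : ‖(n : L)‖ = ‖(n : ℚ_[p])‖ := by
  rw [← map_natCast (algebraMap ℚ_[p] L), norm_algebraMap']

/-- A normed field is ultrametric as soon as its natural numbers have norm at most `1`, and this is
inherited from `ℚ_[p]`. -/
lemma isUltrametricDist_of_padic (p : ℕ) [Fact p.Prime] (L : Type*) [NormedField L]
    [NormedAlgebra ℚ_[p] L] : IsUltrametricDist L :=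
  IsUltrametricDist.isUltrametricDist_of_forall_norm_natCast_le_one fun n => by
    rw [norm_natCast_eq_padic p]
    exact IsUltrametricDist.norm_natCast_le_one _ n

variable (p : ℕ) [hp : Fact p.Prime] {L : Type*} [NormedField L] [NormedAlgebra ℚ_[p] L]

lemma norm_prime_cast : ‖(p : L)‖ = (p : ℝ)⁻¹ := by
  rw [norm_natCast_eq_padic p, Padic.norm_p]

/-- If `C ^ (p - 1) ≤ 1 / p`, then `C ^ n / |n!| ≤ C` for `n ≥ 1`. -/
lemma pow_le_mul_norm_factorial {C : ℝ} (hC : 0 ≤ C) (hCp : C ^ (p - 1) ≤ (p : ℝ)⁻¹) {n : ℕ}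
    (hn : n ≠ 0) : C ^ n ≤ C * ‖((n.factorial : ℕ) : L)‖ := by
  have hp1 : p - 1 ≠ 0 := by have := hp.out.two_le; omega
  have hp0 : (0 : ℝ) < p := by exact_mod_cast hp.out.pos
  obtain ⟨m, rfl⟩ : ∃ m, n = m + 1 := ⟨n - 1, by omega⟩
  rw [pow_succ', norm_natCast_eq_padic p]
  refine mul_le_mul_of_nonneg_left ?_ hC
  rw [Padic.norm_eq_zpow_neg_valuation (by exact_mod_cast Nat.factorial_ne_zero _),
    Padic.valuation_natCast, zpow_neg, zpow_natCast, ← inv_pow]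
  -- After raising to the power `p - 1`, the claim is Legendre's estimate `(p - 1) v_p(n!) ≤ n - 1`.
  refine (pow_le_pow_iff_left₀ (by positivity) (by positivity) hp1).1 ?_
  rw [← pow_mul, mul_comm m, pow_mul, ← pow_mul _ _ (p - 1), mul_comm _ (p - 1)]
  refine (pow_le_pow_left₀ (by positivity) hCp m).trans ?_
  refine pow_le_pow_of_le_one (by positivity) ?_ ?_
  · exact inv_le_one_of_one_le₀ (by exact_mod_cast hp.out.one_le)
  · exact Nat.lt_succ_iff.1 (sub_one_mul_padicValNat_factorial_lt_of_ne_zero p hn)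

variable [CharZero L]

/-- If `Q` has Gauss norm at most `C ≤ p ^ (-1 / (p - 1))`, then so has `exp Q - 1`. -/
lemma CoeffBound.formalExp_sub_one {r C : ℝ} (hr : 0 ≤ r) (hC : 0 ≤ C)
    (hCp : C ^ (p - 1) ≤ (p : ℝ)⁻¹) {Q : L⟦X⟧} (hQ0 : constantCoeff Q = 0)
    (hQ : CoeffBound r C Q) : CoeffBound r C (formalExp Q - 1) := by
  have := isUltrametricDist_of_padic p L
  intro i
  have hfin := coeff_subst_finite' (HasSubst.of_constantCoeff_zero' hQ0) (PowerSeries.exp L) i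
  rcases Nat.eq_zero_or_pos i with rfl | hi
  · rw [map_sub, coeff_zero_formalExp hQ0]
    simpa using hC
  rw [map_sub, PowerSeries.coeff_one, if_neg hi.ne', sub_zero, formalExp,
    coeff_subst' (HasSubst.of_constantCoeff_zero' hQ0), finsum_eq_sum _ hfin]
  -- Each term `Q^n / n!` with `n ≥ 1` has Gauss norm at most `C^n / |n!| ≤ C`.
  refine norm_sum_mul_pow_le (by positivity) hC fun n hn => ?_
  rcases Nat.eq_zero_or_pos n with rfl | hn0
  · simpa [PowerSeries.coeff_one, hi.ne'] using hC
  have h1 := hQ.pow hr hC n i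
  have h2 := pow_le_mul_norm_factorial p (L := L) hC hCp hn0.ne'
  have h3 : 0 < ‖((n.factorial : ℕ) : L)‖ :=
    norm_pos_iff.2 (by exact_mod_cast Nat.factorial_ne_zero _)
  rw [PowerSeries.coeff_exp, smul_eq_mul, norm_mul, mul_assoc]
  have h4 : ‖algebraMap ℚ L (1 / (n.factorial : ℚ))‖ = ‖((n.factorial : ℕ) : L)‖⁻¹ := by
    simp
  rw [h4, inv_mul_le_iff₀ h3, mul_comm _ C]
  exact h1.trans h2

end Norms

/-! ### The Artin-Hasse exponential and its integrality -/

noncomputable section ArtinHasse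

/-- The logarithm `∑ T ^ (p ^ k) / p ^ k` of the Artin-Hasse exponential. -/
def artinHasseLog (p : ℕ) (F : Type*) [Field F] : F⟦X⟧ :=
  -- The test selects the powers of `p`; it fails at `i = 0` because `Nat.log p 0 = 0`, so the
  -- constant term vanishes.
  PowerSeries.mk fun i => if p ^ Nat.log p i = i then (i : F)⁻¹ else 0

lemma coeff_artinHasseLog (p : ℕ) (F : Type*) [Field F] (i : ℕ) :
    PowerSeries.coeff i (artinHasseLog p F) = if p ^ Nat.log p i = i then (i : F)⁻¹ else 0 :=
  PowerSeries.coeff_mk _ _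

lemma constantCoeff_artinHasseLog (p : ℕ) (F : Type*) [Field F] :
    constantCoeff (artinHasseLog p F) = 0 := by
  rw [← coeff_zero_eq_constantCoeff_apply, coeff_artinHasseLog]
  simp

lemma coeff_one_artinHasseLog (p : ℕ) (F : Type*) [Field F] :
    PowerSeries.coeff 1 (artinHasseLog p F) = 1 := by
  rw [coeff_artinHasseLog]
  simp

lemma map_artinHasseLog (p : ℕ) {F E : Type*} [Field F] [Field E] (φ : F →+* E) :
    (artinHasseLog p F).map φ = artinHasseLog p E := by
  ext i
  rw [PowerSeries.coeff_map, coeff_artinHasseLog, coeff_artinHasseLog]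
  split_ifs <;> simp

variable (p : ℕ) [hp : Fact p.Prime]

/-- Multiplying by `p` turns the term `T^(p^k) / p^k` into the term of index `k - 1` evaluated at
`T^p`; only `k = 0` is left over, as `pT`. -/
lemma prime_mul_artinHasseLog (F : Type*) [Field F] [CharZero F] :
    (p : F⟦X⟧) * artinHasseLog p F =
      (artinHasseLog p F).subst (PowerSeries.X ^ p : F⟦X⟧) + (p : F⟦X⟧) * PowerSeries.X := by
  have hp0 : (p : F) ≠ 0 := by exact_mod_cast hp.out.ne_zero
  ext i
  rw [← map_natCast (PowerSeries.C (R := F)), map_add, PowerSeries.coeff_C_mul,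
    PowerSeries.coeff_C_mul, coeff_subst_X_pow hp.out.ne_zero, coeff_artinHasseLog,
    PowerSeries.coeff_X]
  by_cases hpi : p ∣ i
  · obtain ⟨m, rfl⟩ := hpi
    rw [if_pos (dvd_mul_right p m), Nat.mul_div_cancel_left m hp.out.pos, coeff_artinHasseLog,
      if_neg (fun h : p * m = 1 => hp.out.one_lt.ne' (Nat.eq_one_of_mul_eq_one_right h)),
      mul_zero, add_zero]
    rcases Nat.eq_zero_or_pos m with rfl | hm
    · simp
    · have h1 : Nat.log p (p * m) = Nat.log p m + 1 := by
        rw [mul_comm, Nat.log_mul_base hp.out.one_lt hm.ne']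
      have h2 : p ^ (Nat.log p m + 1) = p * m ↔ p ^ Nat.log p m = m := by
        rw [pow_succ', Nat.mul_right_inj hp.out.ne_zero]
      simp only [h1, h2]
      split_ifs
      · have : (m : F) ≠ 0 := by exact_mod_cast hm.ne'
        simp only [Algebra.algebraMap_self, RingHom.id_apply]
        push_cast
        field_simp
      · simp
  · rw [if_neg hpi, zero_add]
    by_cases hi : i = 1
    · subst hi
      simp
    · rw [if_neg hi, if_neg, mul_zero]
      intro h
      have hl : Nat.log p i ≠ 0 := fun h0 => hi (by rw [← h, h0, pow_zero])
      exact hpi (h ▸ dvd_pow_self p hl)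

/-- The functional equation `E(T) ^ p = E(T ^ p) exp (p T)` of the Artin-Hasse exponential. -/
lemma artinHasse_pow_prime (F : Type*) [Field F] [CharZero F] :
    formalExp (artinHasseLog p F) ^ p =
      (formalExp (artinHasseLog p F)).subst (PowerSeries.X ^ p : F⟦X⟧) * formalExp ((p : F⟦X⟧) * PowerSeries.X) := by
  have h0 := constantCoeff_artinHasseLog p F
  have hX : constantCoeff (PowerSeries.X ^ p : F⟦X⟧) = 0 := by simp [hp.out.ne_zero]
  rw [← formalExp_natCast_mul h0, prime_mul_artinHasseLog, formalExp_add, formalExp_subst h0 hX]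
  · exact constantCoeff_subst_eq_zero hX _ h0
  · simp

lemma coeff_mul_of_coeff_lt_eq_zero {R : Type*} [CommRing R] {G H : R⟦X⟧} {n : ℕ}
    (hG : ∀ i < n, PowerSeries.coeff i G = 0) :
    PowerSeries.coeff n (G * H) = PowerSeries.coeff n G * constantCoeff H := by
  rw [PowerSeries.coeff_mul, Finset.sum_eq_single (n, 0)]
  · simp
  · intro x hx hne
    have hx := Finset.HasAntidiagonal.mem_antidiagonal.1 hx
    rw [hG, zero_mul]
    by_contra hlt
    exact hne (Prod.ext (by simp; omega) (by simp; omega))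
  · simp

/-- Frobenius: `t(T)^p = t(T^p)` over the field with `p` elements, and the kernel of reduction is
generated by `p`. -/
lemma PadicInt.norm_coeff_pow_sub_expand_le (t : Polynomial ℤ_[p]) (n : ℕ) :
    ‖(t ^ p - Polynomial.expand ℤ_[p] p t).coeff n‖ ≤ (p : ℝ)⁻¹ := by
  have h : (t ^ p - Polynomial.expand ℤ_[p] p t).map (PadicInt.toZMod (p := p)) = 0 := by
    rw [Polynomial.map_sub, Polynomial.map_pow, Polynomial.map_expand, ZMod.expand_card, sub_self]
  have h1 := congrArg (fun f => Polynomial.coeff f n) h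
  simp only [Polynomial.coeff_map, Polynomial.coeff_zero] at h1
  have h2 : (t ^ p - Polynomial.expand ℤ_[p] p t).coeff n ∈ RingHom.ker (PadicInt.toZMod (p := p)) :=
    h1
  rw [PadicInt.ker_toZMod, PadicInt.maximalIdeal_eq_span_p, Ideal.mem_span_singleton] at h2
  obtain ⟨c, hc⟩ := h2
  rw [hc, norm_mul, PadicInt.norm_p]
  exact mul_le_of_le_one_right (by positivity) (PadicInt.norm_le_one c)

/-- This puts `pT` within the range where the exponential is controlled, also for `p = 2`, where it
is an equality. -/
lemma inv_prime_pow_le : ((p : ℝ)⁻¹) ^ (p - 1) ≤ (p : ℝ)⁻¹ :=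
  pow_le_of_le_one (by positivity)
    (inv_le_one_of_one_le₀ (by exact_mod_cast hp.out.one_le))
    (by have := hp.out.two_le; omega)

/-- The Artin-Hasse exponential has integral coefficients. -/
lemma norm_coeff_artinHasse_le_one (n : ℕ) :
    ‖PowerSeries.coeff n (formalExp (artinHasseLog p ℚ_[p]))‖ ≤ 1 := by
  set E := formalExp (artinHasseLog p ℚ_[p]) with hE
  have hp0 : (0 : ℝ) < p := by exact_mod_cast hp.out.pos
  induction n using Nat.strong_induction_on with
  | _ n ih =>
  have hE0 : constantCoeff E = 1 := constantCoeff_formalExp (constantCoeff_artinHasseLog p ℚ_[p])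
  rcases Nat.eq_zero_or_pos n with rfl | hn
  · rw [coeff_zero_eq_constantCoeff_apply, hE0, norm_one]
  -- the truncation of `E` below degree `n`, over `ℤ_[p]`
  obtain ⟨c, hc⟩ : ∃ c : Fin n → ℤ_[p], ∀ m, (c m : ℚ_[p]) = PowerSeries.coeff m E :=
    ⟨fun m => ⟨PowerSeries.coeff m E, ih m m.2⟩, fun m => rfl⟩
  set t : Polynomial ℤ_[p] := ∑ m : Fin n, Polynomial.monomial m (c m) with ht
  set T : ℚ_[p]⟦X⟧ := ((t.map (algebraMap ℤ_[p] ℚ_[p]) : Polynomial ℚ_[p]) : ℚ_[p]⟦X⟧) with hT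
  have htcoeff : ∀ i < n, (t.coeff i : ℚ_[p]) = PowerSeries.coeff i E := by
    intro i hi
    rw [ht, Polynomial.finsetSum_coeff, Finset.sum_eq_single ⟨i, hi⟩]
    · simp [hc]
    · intro b _ hb
      rw [Polynomial.coeff_monomial, if_neg]
      exact fun h => hb (Fin.ext h)
    · simp
  have hTlt : ∀ i < n, PowerSeries.coeff i T = PowerSeries.coeff i E := by
    intro i hi
    rw [hT, Polynomial.coeff_coe, Polynomial.coeff_map]
    exact htcoeff i hi
  have hTn : PowerSeries.coeff n T = 0 := by
    rw [hT, Polynomial.coeff_coe, Polynomial.coeff_map, ht, Polynomial.finsetSum_coeff,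
      Finset.sum_eq_zero, map_zero]
    intro b _
    rw [Polynomial.coeff_monomial, if_neg b.2.ne]
  have hT0 : constantCoeff T = 1 := by
    rw [← coeff_zero_eq_constantCoeff_apply, hTlt 0 hn, coeff_zero_eq_constantCoeff_apply, hE0]
  -- comparison of the coefficients of `E ^ p` and `T ^ p`
  have h1 : PowerSeries.coeff n (E ^ p) = PowerSeries.coeff n (T ^ p) +
      PowerSeries.coeff n E * p := by
    -- `E - T` starts in degree at least `n`, and the cofactor has constant term `p`.
    have : E ^ p = T ^ p + (E - T) * ∑ i ∈ Finset.range p, E ^ i * T ^ (p - 1 - i) := by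
      rw [mul_comm, geom_sum₂_mul]
      ring
    rw [this, map_add, coeff_mul_of_coeff_lt_eq_zero (fun i hi => by
      rw [map_sub, hTlt i hi, sub_self]), map_sub, hTn, sub_zero]
    simp [hE0, hT0]
  have h2 : ‖PowerSeries.coeff n (T ^ p) -
      PowerSeries.coeff n (E.subst (PowerSeries.X ^ p : ℚ_[p]⟦X⟧))‖ ≤ (p : ℝ)⁻¹ := by
    have h3 := PadicInt.norm_coeff_pow_sub_expand_le p t n
    have h4 : PowerSeries.coeff n (T ^ p) = (((t ^ p).coeff n : ℤ_[p]) : ℚ_[p]) := by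
      rw [hT, ← Polynomial.coe_pow, ← Polynomial.map_pow, Polynomial.coeff_coe,
        Polynomial.coeff_map]
      rfl
    have h5 : PowerSeries.coeff n (E.subst (PowerSeries.X ^ p : ℚ_[p]⟦X⟧)) =
        (((Polynomial.expand ℤ_[p] p t).coeff n : ℤ_[p]) : ℚ_[p]) := by
      rw [coeff_subst_X_pow hp.out.ne_zero, Polynomial.coeff_expand hp.out.pos]
      split_ifs with hd
      · rw [htcoeff _ (Nat.div_lt_self hn hp.out.one_lt)]
        rfl
      · simp
    rw [h4, h5, ← PadicInt.coe_sub, ← Polynomial.coeff_sub]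
    exact h3
  have h6 : ‖PowerSeries.coeff n (E ^ p) -
      PowerSeries.coeff n (E.subst (PowerSeries.X ^ p : ℚ_[p]⟦X⟧))‖ ≤ (p : ℝ)⁻¹ := by
    have hpX : CoeffBound 1 (p : ℝ)⁻¹ (formalExp ((p : ℚ_[p]⟦X⟧) * PowerSeries.X) - 1) := by
      refine CoeffBound.formalExp_sub_one p zero_le_one (by positivity) (inv_prime_pow_le p)
        (by simp) fun i => ?_
      rw [← map_natCast (PowerSeries.C (R := ℚ_[p])), PowerSeries.coeff_C_mul, norm_mul,
        one_pow, mul_one, Padic.norm_p, PowerSeries.coeff_X]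
      refine mul_le_of_le_one_right (by positivity) ?_
      split_ifs <;> simp
    have h7 : E ^ p - E.subst (PowerSeries.X ^ p : ℚ_[p]⟦X⟧) =
        E.subst (PowerSeries.X ^ p : ℚ_[p]⟦X⟧) * (formalExp ((p : ℚ_[p]⟦X⟧) * PowerSeries.X) - 1) := by
      rw [hE, artinHasse_pow_prime]
      ring
    rw [← map_sub, h7, PowerSeries.coeff_mul]
    refine IsUltrametricDist.norm_sum_le_of_forall_le_of_nonneg (by positivity) fun x hx => ?_
    have hx := Finset.HasAntidiagonal.mem_antidiagonal.1 hx
    rw [norm_mul]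
    have h8 := hpX x.2
    rw [one_pow, mul_one] at h8
    refine (mul_le_of_le_one_left (norm_nonneg _) ?_).trans h8
    -- `E(T^p)` involves in degree at most `n` only coefficients of `E` of index below `n`, to which
    -- the induction applies.
    rw [coeff_subst_X_pow hp.out.ne_zero]
    split_ifs
    · refine ih _ ?_
      rcases Nat.eq_zero_or_pos x.1 with h0 | h0
      · simpa [h0] using hn
      · exact (Nat.div_lt_self h0 hp.out.one_lt).trans_le (by omega)
    · simp
  have h9 : ‖PowerSeries.coeff n E * p‖ ≤ (p : ℝ)⁻¹ := by
    have : PowerSeries.coeff n E * p = (PowerSeries.coeff n (E ^ p) -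
        PowerSeries.coeff n (E.subst (PowerSeries.X ^ p : ℚ_[p]⟦X⟧))) - (PowerSeries.coeff n (T ^ p) -
        PowerSeries.coeff n (E.subst (PowerSeries.X ^ p : ℚ_[p]⟦X⟧))) := by
      rw [h1]
      ring
    rw [this]
    refine (sub_eq_add_neg (_ : ℚ_[p]) _ ▸ IsUltrametricDist.norm_add_le_max _ _).trans ?_
    rw [norm_neg]
    exact max_le h6 h2
  rw [norm_mul, Padic.norm_p] at h9
  exact le_of_mul_le_mul_right (by simpa using h9) (inv_pos.2 hp0)

/-- The series `f (a T ^ n)`. -/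
def dilate {F : Type*} [Field F] (n : ℕ) (a : F) (f : F⟦X⟧) : F⟦X⟧ :=
  (rescale a f).subst (PowerSeries.X ^ n : F⟦X⟧)

lemma coeff_dilate {F : Type*} [Field F] {n : ℕ} (hn : n ≠ 0) (a : F) (f : F⟦X⟧) (i : ℕ) :
    PowerSeries.coeff i (dilate n a f) =
      if n ∣ i then a ^ (i / n) * PowerSeries.coeff (i / n) f else 0 := by
  rw [dilate, coeff_subst_X_pow hn, PowerSeries.coeff_rescale]
  rfl

lemma constantCoeff_dilate {F : Type*} [Field F] {n : ℕ} (hn : n ≠ 0) (a : F) {f : F⟦X⟧}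
    (hf : constantCoeff f = 0) : constantCoeff (dilate n a f) = 0 := by
  rw [← coeff_zero_eq_constantCoeff_apply, coeff_dilate hn]
  simp [hf]

lemma formalExp_dilate {F : Type*} [Field F] [CharZero F] {n : ℕ} (hn : n ≠ 0) (a : F)
    {f : F⟦X⟧} (hf : constantCoeff f = 0) :
    formalExp (dilate n a f) = dilate n a (formalExp f) := by
  have h1 : constantCoeff (a • PowerSeries.X : F⟦X⟧) = 0 := by
    rw [← coeff_zero_eq_constantCoeff_apply]
    simp
  have h2 : constantCoeff (rescale a f) = 0 := by
    rw [← coeff_zero_eq_constantCoeff_apply, PowerSeries.coeff_rescale]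
    simp [hf]
  rw [dilate, dilate, rescale_eq_subst, rescale_eq_subst, formalExp_subst hf h1,
    formalExp_subst (by rw [← rescale_eq_subst]; exact h2) (by simp [hn])]

variable {L : Type*} [NormedField L] [NormedAlgebra ℚ_[p] L] [CharZero L]

lemma coeffBound_artinHasse :
    CoeffBound 1 1 (formalExp (artinHasseLog p L)) := by
  intro i
  rw [← map_artinHasseLog p (algebraMap ℚ_[p] L),
    formalExp_map _ (constantCoeff_artinHasseLog p _), PowerSeries.coeff_map, norm_algebraMap',
    one_pow, mul_one]
  exact norm_coeff_artinHasse_le_one p i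

lemma coeffBound_formalExp_dilate {r : ℝ} (hr : 0 ≤ r) {n : ℕ} (hn : n ≠ 0) {a : L}
    (ha : ‖a‖ * r ^ n ≤ 1) :
    CoeffBound r 1 (formalExp (dilate n a (artinHasseLog p L))) := by
  intro i
  rw [formalExp_dilate hn a (constantCoeff_artinHasseLog p L), coeff_dilate hn]
  split_ifs with h
  · obtain ⟨m, rfl⟩ := h
    have h1 := coeffBound_artinHasse p (L := L) m
    rw [one_pow, mul_one] at h1
    rw [Nat.mul_div_cancel_left m (Nat.pos_of_ne_zero hn), norm_mul, norm_pow, pow_mul,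
      mul_right_comm, ← mul_pow]
    exact mul_le_one₀ (pow_le_one₀ (by positivity) ha) (norm_nonneg _) h1
  · simp

lemma coeffBound_formalExp_neg_dilate {r : ℝ} (hr : 0 ≤ r) {n : ℕ} (hn : n ≠ 0) {a : L}
    (ha : ‖a‖ * r ^ n ≤ 1) :
    CoeffBound r 1 (formalExp (-dilate n a (artinHasseLog p L))) := by
  have := isUltrametricDist_of_padic p L
  have h0 := constantCoeff_dilate hn a (constantCoeff_artinHasseLog p L)
  exact (coeffBound_formalExp_dilate p hr hn ha).of_mul_eq_one hr
    (coeff_zero_formalExp h0) (formalExp_mul_neg h0)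

end ArtinHasse

/-! ### The levels `d_n` -/

section FloorLog

variable {p : ℕ}

lemma floorLog_antitone (p D : ℕ) {m n : ℕ} (hm : 1 ≤ m) (h : m ≤ n) :
    floorLog p D n ≤ floorLog p D m :=
  Nat.log_mono_right (Nat.div_le_div_left h hm)

/-- Multiplying the index by `p` lowers the level by one, just as raising to the `p`-th power lowers
the order of a root of unity. The subtraction is truncated at zero. -/
lemma floorLog_mul_pow (p D n k : ℕ) : floorLog p D (n * p ^ k) = floorLog p D n - k := by
  rw [floorLog, floorLog, ← Nat.div_div_eq_div_mul, Nat.log_div_base_pow]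

lemma lt_mul_pow_floorLog_add_one (hp : 1 < p) {D n : ℕ} (hn : 1 ≤ n) :
    D < n * p ^ (floorLog p D n + 1) := by
  have := Nat.lt_pow_succ_log_self hp (D / n)
  rwa [Nat.div_lt_iff_lt_mul hn, mul_comm] at this

lemma le_floorLog_of_mul_pow_le (hp : 1 < p) {D n k : ℕ} (hn : 1 ≤ n) (h : n * p ^ k ≤ D) :
    k ≤ floorLog p D n :=
  Nat.le_log_of_pow_le hp ((Nat.le_div_iff_mul_le hn).2 (by rwa [mul_comm]))

end FloorLog

/-! ### Distance to `1` of roots of unity of `p`-power order -/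

section RootsOfUnity

variable {L : Type*} [NormedField L] [IsUltrametricDist L]

lemma norm_pow_sub_one_le {ξ : L} (hξ : ‖ξ‖ ≤ 1) (i : ℕ) : ‖ξ ^ i - 1‖ ≤ ‖ξ - 1‖ := by
  rw [← geom_sum_mul, norm_mul]
  refine mul_le_of_le_one_left (norm_nonneg _) ?_
  refine IsUltrametricDist.norm_sum_le_of_forall_le_of_nonneg zero_le_one fun j _ => ?_
  rw [norm_pow]
  exact pow_le_one₀ (norm_nonneg _) hξ

/-- `|ξ - 1| = p ^ (-1 / (p ^ k (p - 1)))` for a root of unity `ξ` of order `p ^ (k + 1)`. -/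
lemma IsPrimitiveRoot.norm_sub_one_pow {p : ℕ} [hp : Fact p.Prime]
    (hpL : ‖(p : L)‖ = (p : ℝ)⁻¹) {k : ℕ} {ξ : L} (hξ : IsPrimitiveRoot ξ (p ^ (k + 1))) :
    ‖ξ - 1‖ ^ (p ^ k * (p - 1)) = (p : ℝ)⁻¹ := by
  have hpos : 0 < p ^ (k + 1) := pow_pos hp.out.pos _
  have hnorm : ∀ μ : L, IsPrimitiveRoot μ (p ^ (k + 1)) → ‖μ‖ ≤ 1 := fun μ hμ =>
    ((pow_eq_one_iff_of_nonneg (norm_nonneg _) hpos.ne').1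
      (by rw [← norm_pow, hμ.pow_eq_one, norm_one])).le
  -- Primitive roots of the same order are powers of one another, so they all lie at the same
  -- distance from `1`.
  have hle : ∀ μ ν : L, IsPrimitiveRoot μ (p ^ (k + 1)) → IsPrimitiveRoot ν (p ^ (k + 1)) →
      ‖μ - 1‖ ≤ ‖ν - 1‖ := by
    intro μ ν hμ hν
    have : NeZero (p ^ (k + 1)) := ⟨hpos.ne'⟩
    obtain ⟨i, _, rfl⟩ := hν.eq_pow_of_pow_eq_one hμ.pow_eq_one
    exact norm_pow_sub_one_le (hnorm ν hν) i
  -- The value `p` of the cyclotomic polynomial at `1` is the product of the `p^k (p - 1)`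
  -- differences `1 - μ`, all of the same norm.
  have h1 := Polynomial.eval_one_cyclotomic_prime_pow (R := L) (p := p) k
  rw [Polynomial.cyclotomic_eq_prod_X_sub_primitiveRoots hξ, Polynomial.eval_prod] at h1
  have h2 := congrArg norm h1
  rw [norm_prod, hpL, Finset.prod_congr rfl (g := fun _ => ‖ξ - 1‖), Finset.prod_const,
    hξ.card_primitiveRoots, Nat.totient_prime_pow_succ hp.out] at h2
  · exact h2
  · intro μ hμ
    have hμ := (mem_primitiveRoots hpos).1 hμ
    rw [Polynomial.eval_sub, Polynomial.eval_X, Polynomial.eval_C, norm_sub_rev]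
    exact le_antisymm (hle _ _ hμ hξ) (hle _ _ hξ hμ)

end RootsOfUnity

/-! ### Artin-Hasse coordinates and the decomposition of `P` -/

noncomputable section Coordinates

variable {L : Type*} [Field L]

/-- The coordinates `λ_n` for which `∑ b_n T ^ n = ∑_n ℓ (λ_n T ^ n)`, where `ℓ` is the logarithm
of the Artin-Hasse exponential. -/
def artinHasseCoord (p : ℕ) (b : ℕ → L) : ℕ → L
  -- In degree `N` only the divisors of `N` contribute, and `n = N` contributes `λ_N` itself since
  -- `ℓ` starts with `T`: the system is triangular.
  | N => b N - ∑ n ∈ N.properDivisors.attach, artinHasseCoord p b n.1 ^ (N / n.1) *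
      PowerSeries.coeff (N / n.1) (artinHasseLog p L)
termination_by N => N
decreasing_by exact (Nat.mem_properDivisors.1 n.2).2

lemma sum_divisors_artinHasseCoord (p : ℕ) (b : ℕ → L) {N : ℕ} (hN : N ≠ 0) :
    ∑ n ∈ N.divisors, artinHasseCoord p b n ^ (N / n) *
      PowerSeries.coeff (N / n) (artinHasseLog p L) = b N := by
  rw [← Nat.insert_self_properDivisors hN, Finset.sum_insert Nat.self_notMem_properDivisors,
    Nat.div_self (Nat.pos_of_ne_zero hN), coeff_one_artinHasseLog, pow_one, mul_one]
  conv_lhs => rw [artinHasseCoord]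
  rw [Finset.sum_attach N.properDivisors (fun n => artinHasseCoord p b n ^ (N / n) *
    PowerSeries.coeff (N / n) (artinHasseLog p L))]
  ring

lemma sum_Icc_artinHasseCoord (p : ℕ) (b : ℕ → L) {N D : ℕ} (hN : N ≠ 0) (hND : N ≤ D) :
    ∑ n ∈ Finset.Icc 1 D, (if n ∣ N then artinHasseCoord p b n ^ (N / n) *
      PowerSeries.coeff (N / n) (artinHasseLog p L) else 0) = b N := by
  rw [← sum_divisors_artinHasseCoord p b hN, ← Finset.sum_filter]
  refine Finset.sum_congr ?_ fun _ _ => rfl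
  ext n
  simp only [Finset.mem_filter, Finset.mem_Icc, Nat.mem_divisors]
  constructor
  · exact fun h => ⟨h.2, hN⟩
  · exact fun h => ⟨⟨Nat.pos_of_dvd_of_pos h.1 (Nat.pos_of_ne_zero hN),
      (Nat.le_of_dvd (Nat.pos_of_ne_zero hN) h.1).trans hND⟩, h.1⟩

/-- The root of unity `ζ_{d_n}`, of order `p ^ (d_n + 1)`. -/
def levelRoot (p D : ℕ) (ζ : L) (n : ℕ) : L := ζ ^ p ^ (floorLog p D 1 - floorLog p D n)

lemma levelRoot_isPrimitiveRoot {p D : ℕ} (hp : p.Prime) {ζ : L}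
    (hζ : IsPrimitiveRoot ζ (p ^ (floorLog p D 1 + 1))) {n : ℕ} (hn : 1 ≤ n) :
    IsPrimitiveRoot (levelRoot p D ζ n) (p ^ (floorLog p D n + 1)) := by
  have h := floorLog_antitone p D le_rfl hn
  refine hζ.pow (pow_pos hp.pos _) ?_
  rw [← pow_add]
  congr 1
  omega

lemma levelRoot_sub_one_ne_zero {p D : ℕ} (hp : p.Prime) {ζ : L}
    (hζ : IsPrimitiveRoot ζ (p ^ (floorLog p D 1 + 1))) {n : ℕ} (hn : 1 ≤ n) :
    levelRoot p D ζ n - 1 ≠ 0 :=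
  sub_ne_zero.2 ((levelRoot_isPrimitiveRoot hp hζ hn).ne_one
    (Nat.one_lt_pow (Nat.succ_ne_zero _) hp.one_lt))

lemma levelRoot_pow {p D : ℕ} {ζ : L} {n k : ℕ} (hn : 1 ≤ n) (hk : k ≤ floorLog p D n) :
    levelRoot p D ζ n ^ p ^ k = levelRoot p D ζ (n * p ^ k) := by
  have h := floorLog_antitone p D le_rfl hn
  rw [levelRoot, levelRoot, floorLog_mul_pow, ← pow_mul, ← pow_add]
  congr 2
  omega

lemma levelRoot_pow_eq_one {p D : ℕ} (hp : p.Prime) {ζ : L}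
    (hζ : IsPrimitiveRoot ζ (p ^ (floorLog p D 1 + 1))) {n k : ℕ} (hn : 1 ≤ n)
    (hk : floorLog p D n < k) : levelRoot p D ζ n ^ p ^ k = 1 :=
  (levelRoot_isPrimitiveRoot hp hζ hn).pow_eq_one_iff_dvd _ |>.2 (pow_dvd_pow p hk)

/-- The series `ℓ (ζ_{d_n} a T ^ n) - ℓ (a T ^ n)`, which is a polynomial of degree at most `D`. -/
def levelTerm (p D : ℕ) (ζ : L) (n : ℕ) (a : L) : L⟦X⟧ :=
  dilate n (levelRoot p D ζ n * a) (artinHasseLog p L) - dilate n a (artinHasseLog p L)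

lemma coeff_levelTerm_of_not_dvd {p D : ℕ} {ζ : L} {n : ℕ} (hn : 1 ≤ n) (a : L) {N : ℕ}
    (hN : ¬ n ∣ N) : PowerSeries.coeff N (levelTerm p D ζ n a) = 0 := by
  rw [levelTerm, map_sub, coeff_dilate (by omega), coeff_dilate (by omega), if_neg hN, if_neg hN,
    sub_zero]

lemma constantCoeff_levelTerm {p D : ℕ} {ζ : L} {n : ℕ} (hn : 1 ≤ n) (a : L) :
    constantCoeff (levelTerm p D ζ n a) = 0 := by
  rw [levelTerm, map_sub, constantCoeff_dilate (by omega) _ (constantCoeff_artinHasseLog p L),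
    constantCoeff_dilate (by omega) _ (constantCoeff_artinHasseLog p L), sub_zero]

/-- For `N = n p^k > D` one has `k > d_n`, so `ζ_{d_n}^(p^k) = 1` and the two series cancel in
degree `N`. -/
lemma coeff_levelTerm_eq_zero {p D : ℕ} (hp : p.Prime) {ζ : L}
    (hζ : IsPrimitiveRoot ζ (p ^ (floorLog p D 1 + 1))) {n : ℕ} (hn : 1 ≤ n) (hnD : n ≤ D) (a : L)
    {N : ℕ} (hN : D < N) : PowerSeries.coeff N (levelTerm p D ζ n a) = 0 := by
  by_cases hd : n ∣ N
  · obtain ⟨m, rfl⟩ := hd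
    rw [levelTerm, map_sub, coeff_dilate (by omega), coeff_dilate (by omega),
      if_pos (dvd_mul_right _ _), if_pos (dvd_mul_right _ _), Nat.mul_div_cancel_left _ hn,
      coeff_artinHasseLog]
    split_ifs with hm
    · have h1 : floorLog p D n < Nat.log p m := by
        by_contra! h
        have h2 := Nat.pow_le_of_le_log (Nat.div_pos hnD hn).ne' h
        rw [hm, Nat.le_div_iff_mul_le hn, mul_comm] at h2
        omega
      rw [mul_pow]
      nth_rw 1 [← hm]
      rw [levelRoot_pow_eq_one hp hζ hn h1, one_mul, sub_self]
    · simp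
  · exact coeff_levelTerm_of_not_dvd hn a hd

/-- For `N = n p^k` the factor is `ζ_{d_n}^(p^k) - 1 = ζ_{d_N} - 1`. It depends on `N` alone, not on
`n`, so it comes out of the sum over `n`. -/
lemma coeff_levelTerm {p D : ℕ} (hp : p.Prime) {ζ : L} {n : ℕ} (hn : 1 ≤ n) (a : L) {N : ℕ}
    (hN0 : N ≠ 0) (hN : N ≤ D) : PowerSeries.coeff N (levelTerm p D ζ n a) =
      (levelRoot p D ζ N - 1) * PowerSeries.coeff N (dilate n a (artinHasseLog p L)) := by
  by_cases hd : n ∣ N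
  · obtain ⟨m, rfl⟩ := hd
    rw [levelTerm, map_sub, coeff_dilate (by omega), coeff_dilate (by omega),
      if_pos (dvd_mul_right _ _), if_pos (dvd_mul_right _ _), Nat.mul_div_cancel_left _ hn,
      coeff_artinHasseLog]
    split_ifs with hm
    · have h1 : levelRoot p D ζ n ^ m = levelRoot p D ζ (n * m) := by
        have := levelRoot_pow (p := p) (D := D) (ζ := ζ) hn
          (le_floorLog_of_mul_pow_le (k := Nat.log p m) hp.one_lt hn (by rwa [hm]))
        rwa [hm] at this
      rw [mul_pow, h1]
      ring
    · simp
  · rw [coeff_levelTerm_of_not_dvd hn a hd, coeff_dilate (by omega), if_neg hd, mul_zero]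

lemma coeff_levelTerm_of_lt {p D : ℕ} {ζ : L} {n : ℕ} (hn : 1 ≤ n) (a : L) {i : ℕ} (hi : i < n) :
    PowerSeries.coeff i (levelTerm p D ζ n a) = 0 := by
  rcases Nat.eq_zero_or_pos i with rfl | h0
  · rw [coeff_zero_eq_constantCoeff_apply, constantCoeff_levelTerm hn]
  · exact coeff_levelTerm_of_not_dvd hn a fun h => absurd (Nat.le_of_dvd h0 h) (by omega)

lemma coeff_levelTerm_self {p D : ℕ} (hp : p.Prime) {ζ : L} {n : ℕ} (hn : 1 ≤ n) (hnD : n ≤ D) (a : L) :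
    PowerSeries.coeff n (levelTerm p D ζ n a) = (levelRoot p D ζ n - 1) * a := by
  rw [coeff_levelTerm hp hn a (by omega) hnD, coeff_dilate (by omega), if_pos dvd_rfl,
    Nat.div_self hn, coeff_one_artinHasseLog, pow_one, mul_one]

variable {K : Type*} [Field K] [Algebra K L]

lemma coeff_tildeP (p : ℕ) (ζ : L) (P : K[X]) (N : ℕ) :
    (tildeP p ζ P).coeff N = if 1 ≤ N ∧ N ≤ P.natDegree then
      algebraMap K L (P.coeff N) / (levelRoot p P.natDegree ζ N - 1) else 0 := by
  rw [tildeP, Polynomial.finsetSum_coeff]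
  simp only [Polynomial.coeff_monomial, Finset.sum_ite_eq', Finset.mem_Icc]
  rfl

lemma coeff_sum_dilate_artinHasseCoord (p : ℕ) (b : ℕ → L) {N D : ℕ} (hN0 : N ≠ 0) (hN : N ≤ D) :
    PowerSeries.coeff N (∑ n ∈ Finset.Icc 1 D,
      dilate n (artinHasseCoord p b n) (artinHasseLog p L)) = b N := by
  rw [map_sum, ← sum_Icc_artinHasseCoord p b hN0 hN]
  refine Finset.sum_congr rfl fun n hn => ?_
  rw [coeff_dilate (by have := (Finset.mem_Icc.1 hn).1; omega)]

/-- `P` is the sum of the series `ℓ (ζ_{d_n} λ_n T ^ n) - ℓ (λ_n T ^ n)`, where the `λ_n` are the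
coordinates of `tildeP`. -/
lemma map_eq_sum_levelTerm {p : ℕ} (hp : p.Prime) {ζ : L} {P : K[X]}
    (hζ : IsPrimitiveRoot ζ (p ^ (floorLog p P.natDegree 1 + 1))) (hP : P.coeff 0 = 0) :
    ((P.map (algebraMap K L) : L[X]) : L⟦X⟧) = ∑ n ∈ Finset.Icc 1 P.natDegree,
      levelTerm p P.natDegree ζ n (artinHasseCoord p (tildeP p ζ P).coeff n) := by
  ext N
  rw [Polynomial.coeff_coe, Polynomial.coeff_map, map_sum]
  rcases Nat.eq_zero_or_pos N with rfl | hN0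
  · rw [hP, map_zero, Finset.sum_eq_zero]
    intro n hn
    rw [coeff_zero_eq_constantCoeff_apply, constantCoeff_levelTerm (Finset.mem_Icc.1 hn).1]
  by_cases hN : N ≤ P.natDegree
  -- The common factor `ζ_{d_N} - 1` cancels the denominator of the coefficient of `P̃`.
  · rw [Finset.sum_congr rfl fun n hn => coeff_levelTerm hp (Finset.mem_Icc.1 hn).1 _ hN0.ne' hN,
      ← Finset.mul_sum, ← map_sum, coeff_sum_dilate_artinHasseCoord p _ hN0.ne' hN, coeff_tildeP,
      if_pos ⟨hN0, hN⟩, mul_div_cancel₀ _ (levelRoot_sub_one_ne_zero hp hζ hN0)]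
  · rw [Polynomial.coeff_eq_zero_of_natDegree_lt (not_le.1 hN), map_zero, Finset.sum_eq_zero]
    exact fun n hn => coeff_levelTerm_eq_zero hp hζ (Finset.mem_Icc.1 hn).1 (Finset.mem_Icc.1 hn).2 _
      (not_le.1 hN)

/-- The coordinates of `tildeP` do not all vanish. -/
lemma exists_artinHasseCoord_ne_zero {p : ℕ} (hp : p.Prime) {ζ : L} {P : K[X]}
    (hζ : IsPrimitiveRoot ζ (p ^ (floorLog p P.natDegree 1 + 1))) (hP : P.coeff 0 = 0)
    (hP0 : P ≠ 0) :
    ∃ n ∈ Finset.Icc 1 P.natDegree, artinHasseCoord p (tildeP p ζ P).coeff n ≠ 0 := by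
  by_contra! h
  refine hP0 (Polynomial.map_injective (algebraMap K L) (algebraMap K L).injective ?_)
  rw [Polynomial.map_zero, ← Polynomial.coe_eq_zero_iff, map_eq_sum_levelTerm hp hζ hP]
  refine Finset.sum_eq_zero fun n hn => ?_
  rw [h n hn, levelTerm, mul_zero, sub_self]

lemma constantCoeff_sum_dilate (p D : ℕ) (b : ℕ → L) :
    constantCoeff (∑ n ∈ Finset.Icc 1 D, dilate n (b n) (artinHasseLog p L)) = 0 := by
  rw [map_sum]
  refine Finset.sum_eq_zero fun n hn => ?_
  rw [constantCoeff_dilate (by have := (Finset.mem_Icc.1 hn).1; omega) _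
    (constantCoeff_artinHasseLog p L)]

lemma constantCoeff_tildeP (p : ℕ) (ζ : L) (P : K[X]) :
    constantCoeff (tildeP p ζ P : L⟦X⟧) = 0 := by
  rw [← coeff_zero_eq_constantCoeff_apply, Polynomial.coeff_coe, coeff_tildeP, if_neg (by simp)]

variable [CharZero L]

/-- Up to degree `D`, the polynomial `tildeE` is the product of the Artin-Hasse exponentials
`E (λ_n T ^ n)`. -/
lemma coeff_tildeE {p : ℕ} {ζ : L} {P : K[X]} {i : ℕ} (hi : i ≤ P.natDegree) :
    (tildeE p ζ P).coeff i = PowerSeries.coeff i (∏ n ∈ Finset.Icc 1 P.natDegree,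
      formalExp (dilate n (artinHasseCoord p (tildeP p ζ P).coeff n) (artinHasseLog p L))) := by
  rw [tildeE, PowerSeries.coeff_trunc, if_pos (by omega), ← formalExp_sum]
  · refine coeff_formalExp_congr (constantCoeff_tildeP p ζ P) (constantCoeff_sum_dilate p _ _)
      (N := P.natDegree) (fun j hj => ?_) i hi
    rcases Nat.eq_zero_or_pos j with rfl | hj0
    · rw [coeff_zero_eq_constantCoeff_apply, coeff_zero_eq_constantCoeff_apply,
        constantCoeff_tildeP, constantCoeff_sum_dilate]
    · rw [coeff_sum_dilate_artinHasseCoord p _ hj0.ne' hj, Polynomial.coeff_coe]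
  · intro n hn
    exact constantCoeff_dilate (by have := (Finset.mem_Icc.1 hn).1; omega) _
      (constantCoeff_artinHasseLog p L)

lemma natDegree_tildeE_le (p : ℕ) (ζ : L) (P : K[X]) :
    (tildeE p ζ P).natDegree ≤ P.natDegree :=
  Nat.lt_succ_iff.1 (PowerSeries.natDegree_trunc_lt _ _)

lemma coeff_zero_tildeE (p : ℕ) (ζ : L) (P : K[X]) : (tildeE p ζ P).coeff 0 = 1 := by
  rw [tildeE, PowerSeries.coeff_trunc, if_pos (by omega),
    coeff_zero_formalExp (constantCoeff_tildeP p ζ P)]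

lemma norm_levelRoot {p D : ℕ} (hp : p.Prime) {L : Type*} [NormedField L] {ζ : L}
    (hζ : IsPrimitiveRoot ζ (p ^ (floorLog p D 1 + 1)))
    {n : ℕ} (hn : 1 ≤ n) :
    ‖levelRoot p D ζ n‖ = 1 :=
  (pow_eq_one_iff_of_nonneg (norm_nonneg _) (pow_pos hp.pos _).ne').1
    (by rw [← norm_pow, (levelRoot_isPrimitiveRoot hp hζ hn).pow_eq_one, norm_one])

end Coordinates

/-! ### The critical radius of a finite family of coordinates -/

section CriticalRadius

/-- The radius `ρ` at which `max ‖b_n‖ ρ ^ n = 1`. -/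
lemma exists_critical_radius {L : Type*} [NormedField L] {b : ℕ → L} {D : ℕ}
    (hb : ∃ n ∈ Finset.Icc 1 D, b n ≠ 0) :
    ∃ ρ : ℝ, 0 < ρ ∧ (∀ n ∈ Finset.Icc 1 D, ‖b n‖ * ρ ^ n ≤ 1) ∧
      ∃ n ∈ Finset.Icc 1 D, ‖b n‖ * ρ ^ n = 1 := by
  obtain ⟨n₀, hn₀, hb₀⟩ := hb
  -- The radius is the inverse of the maximum of `‖b_n‖^(1/n)`.
  obtain ⟨m, hm, hmax⟩ := (Finset.Icc 1 D).exists_max_image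
    (fun n => ‖b n‖ ^ ((n : ℝ)⁻¹)) ⟨n₀, hn₀⟩
  set M := ‖b m‖ ^ ((m : ℝ)⁻¹) with hM
  have hM0 : 0 < M := (Real.rpow_pos_of_pos (norm_pos_iff.2 hb₀) _).trans_le (hmax n₀ hn₀)
  have hpow : ∀ n ∈ Finset.Icc 1 D, (‖b n‖ ^ ((n : ℝ)⁻¹)) ^ n = ‖b n‖ := fun n hn =>
    Real.rpow_inv_natCast_pow (norm_nonneg _) (by have := (Finset.mem_Icc.1 hn).1; omega)
  refine ⟨M⁻¹, inv_pos.2 hM0, fun n hn => ?_, m, hm, ?_⟩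
  · rw [inv_pow, mul_inv_le_iff₀ (by positivity), one_mul, ← hpow n hn]
    exact pow_le_pow_left₀ (by positivity) (hmax n hn) n
  · rw [inv_pow, hM, hpow m hm, mul_inv_cancel₀]
    rw [← hpow m hm]
    positivity

/-- Finitely many strict inequalities `‖b_n‖ ρ ^ n < 1` persist at a slightly larger radius. -/
lemma exists_larger_radius {L : Type*} [NormedField L] {b : ℕ → L} {S : Finset ℕ} {ρ r : ℝ}
    (hr : ρ < r) (h : ∀ n ∈ S, ‖b n‖ * ρ ^ n < 1) :
    ∃ r', ρ < r' ∧ r' < r ∧ ∀ n ∈ S, ‖b n‖ * r' ^ n ≤ 1 := by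
  have h1 : ∀ᶠ x in nhdsWithin ρ (Set.Ioi ρ), ∀ n ∈ S, ‖b n‖ * x ^ n ≤ 1 := by
    rw [Filter.eventually_all_finset]
    intro n hn
    have hc : Continuous fun x : ℝ => ‖b n‖ * x ^ n := by fun_prop
    exact ((hc.tendsto ρ).eventually_lt_const (h n hn)).filter_mono nhdsWithin_le_nhds |>.mono
      fun _ hx => hx.le
  obtain ⟨x, hx, hx1, hx2⟩ := (h1.and (Ioo_mem_nhdsGT hr)).exists
  exact ⟨x, hx1, hx2, hx⟩

end CriticalRadius

/-! ### Unboundedness of critical products beyond `ρ` -/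

section Overconvergence

variable {p : ℕ} [hp : Fact p.Prime] {L : Type*} [NormedField L] [NormedAlgebra ℚ_[p] L]
  {D : ℕ} {ζ : L}

lemma norm_levelRoot_sub_one_pow (hζ : IsPrimitiveRoot ζ (p ^ (floorLog p D 1 + 1))) {n : ℕ}
    (hn : 1 ≤ n) :
    ‖levelRoot p D ζ n - 1‖ ^ (p ^ floorLog p D n * (p - 1)) = (p : ℝ)⁻¹ := by
  have := isUltrametricDist_of_padic p L
  exact (levelRoot_isPrimitiveRoot hp.out hζ hn).norm_sub_one_pow (norm_prime_cast p)

lemma norm_levelRoot_sub_one_le (hζ : IsPrimitiveRoot ζ (p ^ (floorLog p D 1 + 1))) {n : ℕ}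
    (hn : 1 ≤ n) : ‖levelRoot p D ζ n - 1‖ ≤ 1 := by
  have := isUltrametricDist_of_padic p L
  rw [sub_eq_add_neg]
  refine (IsUltrametricDist.norm_add_le_max _ _).trans ?_
  rw [norm_levelRoot hp.out hζ hn, norm_neg, norm_one, max_self]

/-- Gauss norm estimate for `ℓ (ζ_{d_n} a T ^ n) - ℓ (a T ^ n)` at the radius `ρ t`, where
`ρ ^ n = 1 / |a|`. Here `w = p ^ (-1 / (p - 1))`. -/
lemma coeffBound_levelTerm (hζ : IsPrimitiveRoot ζ (p ^ (floorLog p D 1 + 1))) {n : ℕ}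
    (hn : 1 ≤ n) (hnD : n ≤ D) {a : L} {ρ t w : ℝ} (ha : ‖a‖ * ρ ^ n = 1) (ht : 1 ≤ t)
    (hw0 : 0 ≤ w) (hw : w ^ (p - 1) = (p : ℝ)⁻¹) {d : ℕ} (hd : floorLog p D n ≤ d) :
    CoeffBound (ρ * t) ((p : ℝ) ^ d * w * t ^ D) (levelTerm p D ζ n a) := by
  have hp1 : p - 1 ≠ 0 := by have := hp.out.two_le; omega
  have hp0 : (0 : ℝ) < p := by exact_mod_cast hp.out.pos
  have hp1' : (1 : ℝ) ≤ p := by exact_mod_cast hp.out.one_le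
  have ht0 : 0 ≤ t := zero_le_one.trans ht
  have hRHS : 0 ≤ (p : ℝ) ^ d * w * t ^ D := by positivity
  intro N
  by_cases hN : D < N
  · rwa [coeff_levelTerm_eq_zero hp.out hζ hn hnD a hN, norm_zero, zero_mul]
  rcases Nat.eq_zero_or_pos N with rfl | hN0
  · rwa [coeff_levelTerm_of_lt hn a (by omega), norm_zero, zero_mul]
  rw [coeff_levelTerm hp.out hn a hN0.ne' (by omega), coeff_dilate (by omega)]
  split_ifs with hdvd
  swap
  · rwa [mul_zero, norm_zero, zero_mul]
  obtain ⟨m, rfl⟩ := hdvd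
  rw [Nat.mul_div_cancel_left m hn, coeff_artinHasseLog]
  split_ifs with hm
  swap
  · rwa [mul_zero, mul_zero, norm_zero, zero_mul]
  set k := Nat.log p m with hk
  have hkn : k ≤ floorLog p D n :=
    le_floorLog_of_mul_pow_le hp.out.one_lt hn (by rw [hm]; omega)
  have hv := norm_levelRoot_sub_one_pow (L := L) hζ (n := n * m) hN0
  have hv1 := norm_levelRoot_sub_one_le (L := L) hζ (n := n * m) hN0
  set v := ‖levelRoot p D ζ (n * m) - 1‖ with hvdef
  have hmnorm : ‖(m : L)⁻¹‖ = (p : ℝ) ^ k := by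
    rw [norm_inv, ← hm, Nat.cast_pow, norm_pow, norm_prime_cast p, inv_pow, inv_inv]
  have hpow : ‖a‖ ^ m * (ρ * t) ^ (n * m) = t ^ (n * m) := by
    rw [mul_pow, pow_mul ρ, ← mul_assoc, ← mul_pow, ha, one_pow, one_mul]
  -- If `k = d_n`, the root in degree `n p^k` has order `p` and `v = w`. Otherwise `k < d_n ≤ d`,
  -- and the crude bounds `v ≤ 1 ≤ p w` suffice.
  have hvw : v * (p : ℝ) ^ k ≤ (p : ℝ) ^ d * w := by
    rcases hkn.eq_or_lt with hkn | hkn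
    · have h0 : floorLog p D (n * m) = 0 := by
        rw [← hm, floorLog_mul_pow, hkn, Nat.sub_self]
      rw [h0, pow_zero, one_mul, ← hw] at hv
      have hvw : v = w := (pow_left_inj₀ (norm_nonneg _) hw0 hp1).1 hv
      rw [hvw, mul_comm]
      exact mul_le_mul_of_nonneg_right (pow_le_pow_right₀ hp1' (by omega)) hw0
    · have h1 : 1 ≤ p * w := by
        refine (one_le_pow_iff_of_nonneg (by positivity) hp1).1 ?_
        rw [mul_pow, hw, ← div_eq_mul_inv, one_le_div hp0]
        exact le_self_pow₀ hp1' hp1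
      calc v * (p : ℝ) ^ k ≤ 1 * (p : ℝ) ^ k := by gcongr
        _ ≤ (p * w) * (p : ℝ) ^ k := by gcongr
        _ = (p : ℝ) ^ (k + 1) * w := by ring
        _ ≤ (p : ℝ) ^ d * w := by
          gcongr
          omega
  rw [norm_mul, norm_mul, norm_pow, hmnorm]
  calc v * (‖a‖ ^ m * (p : ℝ) ^ k) * (ρ * t) ^ (n * m)
      = v * (p : ℝ) ^ k * (‖a‖ ^ m * (ρ * t) ^ (n * m)) := by ring
    _ = v * (p : ℝ) ^ k * t ^ (n * m) := by rw [hpow]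
    _ ≤ (p : ℝ) ^ d * w * t ^ D := by
      gcongr
      omega

variable [CharZero L]

/-- The exponential is `E(ζ_{d_n} a T^n) / E(a T^n)`. As `ζ_{d_n}` has norm `1`, both Artin-Hasse
factors and their inverses satisfy the bound. -/
lemma coeffBound_formalExp_levelTerm (hζ : IsPrimitiveRoot ζ (p ^ (floorLog p D 1 + 1))) {r : ℝ}
    (hr : 0 ≤ r) {n : ℕ} (hn : 1 ≤ n) {a : L} (ha : ‖a‖ * r ^ n ≤ 1) :
    CoeffBound r 1 (formalExp (levelTerm p D ζ n a)) ∧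
      CoeffBound r 1 (formalExp (-levelTerm p D ζ n a)) := by
  have := isUltrametricDist_of_padic p L
  have hn0 : n ≠ 0 := by omega
  have h0 : ∀ c : L, constantCoeff (dilate n c (artinHasseLog p L)) = 0 := fun c =>
    constantCoeff_dilate hn0 c (constantCoeff_artinHasseLog p L)
  have h0' : ∀ c : L, constantCoeff (-dilate n c (artinHasseLog p L)) = 0 := fun c => by
    rw [map_neg, h0, neg_zero]
  have ha' : ‖levelRoot p D ζ n * a‖ * r ^ n ≤ 1 := by
    rwa [norm_mul, norm_levelRoot hp.out hζ hn, one_mul]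
  constructor
  · rw [levelTerm, sub_eq_add_neg, formalExp_add (h0 _) (h0' _)]
    simpa using (coeffBound_formalExp_dilate p hr hn0 ha').mul hr zero_le_one zero_le_one
      (coeffBound_formalExp_neg_dilate p hr hn0 ha)
  · rw [levelTerm, neg_sub, sub_eq_add_neg, formalExp_add (h0 _) (h0' _)]
    simpa using (coeffBound_formalExp_dilate p hr hn0 ha).mul hr zero_le_one zero_le_one
      (coeffBound_formalExp_neg_dilate p hr hn0 ha')

/-- A nonempty product of the series `exp (ℓ (ζ_{d_n} a_n T ^ n) - ℓ (a_n T ^ n))` with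
`|a_n| = ρ ^ (-n)` is not bounded on a disc of radius larger than `ρ`. -/
lemma not_coeffBound_formalExp_sum_levelTerm
    (hζ : IsPrimitiveRoot ζ (p ^ (floorLog p D 1 + 1))) {S : Finset ℕ} (hS : S ⊆ Finset.Icc 1 D)
    (hSne : S.Nonempty) {a : ℕ → L} {ρ r₁ C : ℝ} (hρ : 0 < ρ)
    (ha : ∀ n ∈ S, ‖a n‖ * ρ ^ n = 1) (hr₁ : ρ < r₁) :
    ¬ CoeffBound r₁ C (formalExp (∑ n ∈ S, levelTerm p D ζ n (a n))) := by
  intro hbound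
  have := isUltrametricDist_of_padic p L
  have hp1 : p - 1 ≠ 0 := by have := hp.out.two_le; omega
  have hp0 : (0 : ℝ) < p := by exact_mod_cast hp.out.pos
  have hp1' : (1 : ℝ) < p := by exact_mod_cast hp.out.one_lt
  have hmem : ∀ n ∈ S, 1 ≤ n ∧ n ≤ D := fun n hn => Finset.mem_Icc.1 (hS hn)
  set Q := ∑ n ∈ S, levelTerm p D ζ n (a n) with hQ
  -- The least index isolates the first coefficient of `Q` and has the largest level among the
  -- indices in `S`.
  obtain ⟨n₀, hn₀, hmin⟩ := S.exists_min_image id hSne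
  simp only [id] at hmin
  obtain ⟨hn₁, hn₀D⟩ := hmem n₀ hn₀
  set d := floorLog p D n₀ with hd
  have hv := norm_levelRoot_sub_one_pow (L := L) hζ hn₁
  have hv1 := norm_levelRoot_sub_one_le (L := L) hζ hn₁
  have hv0 : 0 < ‖levelRoot p D ζ n₀ - 1‖ :=
    norm_pos_iff.2 (levelRoot_sub_one_ne_zero hp.out hζ hn₁)
  set v := ‖levelRoot p D ζ n₀ - 1‖ with hvdef
  -- `w = p^(-1/(p-1))` is the threshold for control of the exponential.
  set w := v ^ p ^ d with hwdef
  have hw : w ^ (p - 1) = (p : ℝ)⁻¹ := by rw [hwdef, ← pow_mul, hv]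
  have hw0 : 0 < w := by positivity
  -- the first coefficient
  have hQlt : ∀ i < n₀, PowerSeries.coeff i Q = 0 := fun i hi => by
    rw [hQ, map_sum]
    exact Finset.sum_eq_zero fun n hn =>
      coeff_levelTerm_of_lt (hmem n hn).1 _ (hi.trans_le (hmin n hn))
  have hQn₀ : PowerSeries.coeff n₀ Q = (levelRoot p D ζ n₀ - 1) * a n₀ := by
    rw [hQ, map_sum, Finset.sum_eq_single n₀, coeff_levelTerm_self hp.out hn₁ hn₀D]
    · exact fun n hn hne => coeff_levelTerm_of_lt (hmem n hn).1 _
        (lt_of_le_of_ne (hmin n hn) hne.symm)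
    · exact fun h => absurd hn₀ h
  have hQ0 : constantCoeff Q = 0 := by
    rw [← coeff_zero_eq_constantCoeff_apply, hQlt 0 (by omega)]
  set g := formalExp Q - 1 with hg
  have hgn₀ : PowerSeries.coeff n₀ g = (levelRoot p D ζ n₀ - 1) * a n₀ := by
    rw [hg, map_sub, PowerSeries.coeff_one, if_neg (by omega), sub_zero,
      coeff_formalExp_of_coeff_eq_zero (by omega) hQlt, hQn₀]
  -- a radius `ρ t` slightly larger than `ρ`
  obtain ⟨t, ht1, htr, htp⟩ : ∃ t : ℝ, 1 < t ∧ ρ * t < r₁ ∧ t ^ D ≤ p := by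
    have hc : Continuous fun x : ℝ => x ^ D := by fun_prop
    have h1 : ∀ᶠ x in nhdsWithin (1 : ℝ) (Set.Ioi 1), x ^ D < (p : ℝ) :=
      ((hc.tendsto 1).eventually_lt_const (by simpa using hp1')).filter_mono nhdsWithin_le_nhds
    have h2 : (1 : ℝ) < r₁ / ρ := (one_lt_div hρ).2 hr₁
    obtain ⟨x, hx, hx1, hx2⟩ := (h1.and (Ioo_mem_nhdsGT h2)).exists
    exact ⟨x, hx1, by rwa [lt_div_iff₀ hρ, mul_comm] at hx2, hx.le⟩
  have ht0 : 0 < t := zero_lt_one.trans ht1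
  have hρt : 0 < ρ * t := by positivity
  have hC : 0 ≤ C := by
    have := hbound 0
    rw [pow_zero, mul_one] at this
    exact (norm_nonneg _).trans this
  have hgbound : CoeffBound r₁ (max C 1) g :=
    (hbound.mono (le_max_left _ _)).sub (hρ.trans hr₁).le (coeffBound_one.mono (le_max_right _ _))
  have han₀ : a n₀ ≠ 0 := by
    intro h
    have := ha n₀ hn₀
    rw [h, norm_zero, zero_mul] at this
    exact zero_ne_one this
  -- The assumed bound at `r₁ > ρt` ensures that the Gauss norm at `ρt` is attained.
  obtain ⟨i, c, hdom, hc⟩ := hgbound.exists_dominates hρt htr (n := n₀) (by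
    rw [hgn₀]
    exact mul_ne_zero (levelRoot_sub_one_ne_zero hp.out hζ hn₁) han₀)
  have hvc : v * t ^ n₀ ≤ c := by
    refine le_of_eq_of_le ?_ hc
    rw [hgn₀, norm_mul, mul_pow, ← hvdef]
    linear_combination (-v * t ^ n₀) * ha n₀ hn₀
  have hvc' : v < c := by
    refine lt_of_lt_of_le ?_ hvc
    exact lt_mul_of_one_lt_right hv0 (one_lt_pow₀ ht1 (by omega))
  have hc0 : 0 < c := hv0.trans hvc'
  -- lower bound for the Gauss norm of `exp (p ^ (d + 1) Q) - 1`
  have hdom' := hdom.one_add_pow_prime_pow hp.out (norm_prime_cast p) hρt hc0 (d + 1) (by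
    intro j hj
    -- Since `c > v`, `v ≤ 1` and `v^(p^d (p-1)) = 1/p`, the condition holds exactly as needed for
    -- the `d + 1` iterations `j ≤ d`.
    rw [← pow_mul]
    calc (p : ℝ)⁻¹ = v ^ (p ^ d * (p - 1)) := hv.symm
      _ ≤ v ^ (p ^ j * (p - 1)) := pow_le_pow_of_le_one hv0.le hv1
          (Nat.mul_le_mul_right _ (Nat.pow_le_pow_right hp.out.pos (by omega)))
      _ < c ^ (p ^ j * (p - 1)) := pow_lt_pow_left₀ hvc' hv0.le
          (Nat.mul_ne_zero (pow_pos hp.out.pos _).ne' hp1))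
  rw [hg, add_sub_cancel, ← formalExp_natCast_mul hQ0] at hdom'
  -- upper bound
  have hQbound : CoeffBound (ρ * t) ((p : ℝ) ^ d * w * t ^ D) Q :=
    CoeffBound.sum hρt.le (by positivity) fun n hn =>
      coeffBound_levelTerm hζ (hmem n hn).1 (hmem n hn).2 (ha n hn) ht1.le hw0.le hw
        (floorLog_antitone p D hn₁ (hmin n hn))
  have hpQ : CoeffBound (ρ * t) ((p : ℝ)⁻¹ * w * t ^ D) (((p ^ (d + 1) : ℕ) : L⟦X⟧) * Q) := by
    intro j
    rw [← map_natCast (PowerSeries.C (R := L)), PowerSeries.coeff_C_mul, norm_mul, Nat.cast_pow,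
      norm_pow, norm_prime_cast p, mul_assoc]
    calc (p : ℝ)⁻¹ ^ (d + 1) * (‖PowerSeries.coeff j Q‖ * (ρ * t) ^ j)
        ≤ (p : ℝ)⁻¹ ^ (d + 1) * ((p : ℝ) ^ d * w * t ^ D) :=
          mul_le_mul_of_nonneg_left (hQbound j) (by positivity)
      _ = (p : ℝ)⁻¹ * w * t ^ D := by
        rw [inv_pow, pow_succ]
        field_simp
  -- The choice `t^D ≤ p` keeps the norm of `p^(d+1) Q` at most `w`.
  have hle : ((p : ℝ)⁻¹ * w * t ^ D) ^ (p - 1) ≤ (p : ℝ)⁻¹ := by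
    refine le_of_le_of_eq (pow_le_pow_left₀ (by positivity) ?_ _) hw
    calc (p : ℝ)⁻¹ * w * t ^ D ≤ (p : ℝ)⁻¹ * w * p := by gcongr
      _ = w := by field_simp
  have hfin := CoeffBound.formalExp_sub_one p hρt.le (by positivity) hle
    (by rw [map_mul, hQ0, mul_zero]) hpQ (p ^ (d + 1) * i)
  rw [hdom'.1] at hfin
  -- comparison
  have hlow : (p : ℝ)⁻¹ * w * t ^ (n₀ * p ^ (d + 1)) ≤ c ^ p ^ (d + 1) := by
    refine le_of_eq_of_le ?_ (pow_le_pow_left₀ (by positivity) hvc (p ^ (d + 1)))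
    rw [mul_pow, ← pow_mul, pow_succ p d, pow_mul v, ← hwdef, ← hw]
    congr 1
    rw [← pow_succ, Nat.sub_add_cancel hp.out.one_le]
  have hlt : t ^ D < t ^ (n₀ * p ^ (d + 1)) :=
    pow_lt_pow_right₀ ht1 (lt_mul_pow_floorLog_add_one hp.out.one_lt hn₁)
  have : (p : ℝ)⁻¹ * w * t ^ D < (p : ℝ)⁻¹ * w * t ^ (n₀ * p ^ (d + 1)) := by gcongr
  linarith

end Overconvergence

/-! ### Transfer to `exp P` and to `ẽ` -/

section Exponential

variable {p : ℕ} [hp : Fact p.Prime] {L : Type*} [NormedField L] [NormedAlgebra ℚ_[p] L]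
  [CharZero L] {K : Type*} [Field K] [Algebra K L] {ζ : L} {P : K[X]}

/-- `exp P` is bounded on the disc whose radius is the critical one of the coordinates. -/
lemma coeffBound_formalExp_map (hζ : IsPrimitiveRoot ζ (p ^ (floorLog p P.natDegree 1 + 1)))
    (hP : P.coeff 0 = 0) {ρ : ℝ} (hρ : 0 < ρ)
    (hle : ∀ n ∈ Finset.Icc 1 P.natDegree,
      ‖artinHasseCoord p (tildeP p ζ P).coeff n‖ * ρ ^ n ≤ 1) :
    CoeffBound ρ 1 (formalExp ((P.map (algebraMap K L) : L[X]) : L⟦X⟧)) := by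
  have := isUltrametricDist_of_padic p L
  rw [map_eq_sum_levelTerm hp.out hζ hP,
    formalExp_sum fun n hn => constantCoeff_levelTerm (Finset.mem_Icc.1 hn).1 _]
  exact CoeffBound.prod hρ.le fun n hn =>
    (coeffBound_formalExp_levelTerm hζ hρ.le (Finset.mem_Icc.1 hn).1 (hle n hn)).1

/-- `exp P` is not bounded on larger discs. -/
lemma not_coeffBound_formalExp_map
    (hζ : IsPrimitiveRoot ζ (p ^ (floorLog p P.natDegree 1 + 1)))
    (hP : P.coeff 0 = 0) {ρ : ℝ} (hρ : 0 < ρ)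
    (hle : ∀ n ∈ Finset.Icc 1 P.natDegree,
      ‖artinHasseCoord p (tildeP p ζ P).coeff n‖ * ρ ^ n ≤ 1)
    (heq : ∃ n ∈ Finset.Icc 1 P.natDegree,
      ‖artinHasseCoord p (tildeP p ζ P).coeff n‖ * ρ ^ n = 1) {r C : ℝ} (hr : ρ < r) :
    ¬ CoeffBound r C (formalExp ((P.map (algebraMap K L) : L[X]) : L⟦X⟧)) := by
  intro hbound
  have := isUltrametricDist_of_padic p L
  set D := P.natDegree with hD
  set a := artinHasseCoord p (tildeP p ζ P).coeff with ha
  classical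
  set S := (Finset.Icc 1 D).filter fun n => ‖a n‖ * ρ ^ n = 1 with hS
  set S' := (Finset.Icc 1 D).filter fun n => ¬ ‖a n‖ * ρ ^ n = 1 with hS'
  obtain ⟨r', hr', hr'r, hle'⟩ := exists_larger_radius (b := a) (S := S') hr fun n hn => by
    obtain ⟨h1, h2⟩ := Finset.mem_filter.1 hn
    exact lt_of_le_of_ne (hle n h1) h2
  have hr'0 : 0 ≤ r' := (hρ.trans hr').le
  have h0 : ∀ T ⊆ Finset.Icc 1 D, ∀ n ∈ T, constantCoeff (levelTerm p D ζ n (a n)) = 0 :=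
    fun T hT n hn => constantCoeff_levelTerm (Finset.mem_Icc.1 (hT hn)).1 _
  have hSs : S ⊆ Finset.Icc 1 D := Finset.filter_subset _ _
  have hSs' : S' ⊆ Finset.Icc 1 D := Finset.filter_subset _ _
  -- The subcritical terms are moved to the other side: the inverses of their exponentials are still
  -- bounded by `1` at `r'`.
  have hsum : ∑ n ∈ S, levelTerm p D ζ n (a n) =
      ((P.map (algebraMap K L) : L[X]) : L⟦X⟧) + ∑ n ∈ S', -levelTerm p D ζ n (a n) := by
    rw [map_eq_sum_levelTerm hp.out hζ hP, ← hD, ← ha, Finset.sum_neg_distrib,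
      ← Finset.sum_filter_add_sum_filter_not (Finset.Icc 1 D) (fun n => ‖a n‖ * ρ ^ n = 1)]
    ring
  refine not_coeffBound_formalExp_sum_levelTerm (C := C * 1) hζ hSs ?_ (a := a) hρ
    (fun n hn => (Finset.mem_filter.1 hn).2) hr' ?_
  · obtain ⟨n, hn, h⟩ := heq
    exact ⟨n, Finset.mem_filter.2 ⟨hn, h⟩⟩
  · have hC : 0 ≤ C := by
      have := hbound 0
      rw [pow_zero, mul_one] at this
      exact (norm_nonneg _).trans this
    have hneg : ∀ n ∈ S', constantCoeff (-levelTerm p D ζ n (a n)) = 0 := fun n hn => by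
      rw [map_neg, h0 S' hSs' n hn, neg_zero]
    rw [hsum, formalExp_add, formalExp_sum hneg]
    · refine (hbound.mono_radius hr'0 hr'r.le).mul hr'0 hC zero_le_one ?_
      exact CoeffBound.prod hr'0 fun n hn => (coeffBound_formalExp_levelTerm hζ hr'0
        (Finset.mem_Icc.1 (hSs' hn)).1 (hle' n hn)).2
    · rw [map_eq_sum_levelTerm hp.out hζ hP, map_sum]
      exact Finset.sum_eq_zero (h0 _ subset_rfl)
    · rw [map_sum]
      exact Finset.sum_eq_zero hneg

lemma norm_coeff_tildeE_le {ρ : ℝ} (hρ : 0 < ρ)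
    (hle : ∀ n ∈ Finset.Icc 1 P.natDegree,
      ‖artinHasseCoord p (tildeP p ζ P).coeff n‖ * ρ ^ n ≤ 1) (i : ℕ) :
    ‖(tildeE p ζ P).coeff i‖ * ρ ^ i ≤ 1 := by
  have := isUltrametricDist_of_padic p L
  by_cases hi : i ≤ P.natDegree
  · rw [coeff_tildeE hi]
    exact CoeffBound.prod hρ.le (fun n hn => coeffBound_formalExp_dilate p hρ.le
      (by have := (Finset.mem_Icc.1 hn).1; omega) (hle n hn)) i
  · rw [Polynomial.coeff_eq_zero_of_natDegree_lt
      ((natDegree_tildeE_le p ζ P).trans_lt (not_le.1 hi)), norm_zero, zero_mul]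
    exact zero_le_one

/-- Take the least critical index `n`. The factors of index below `n` are bounded by `1` on a larger
disc, so their product contributes strictly less than `1` in degree `n`. The factors of index at
least `n` contribute `λ_n`, of size exactly `1`. -/
lemma exists_norm_coeff_tildeE_eq {ρ : ℝ} (hρ : 0 < ρ)
    (hle : ∀ n ∈ Finset.Icc 1 P.natDegree,
      ‖artinHasseCoord p (tildeP p ζ P).coeff n‖ * ρ ^ n ≤ 1)
    (heq : ∃ n ∈ Finset.Icc 1 P.natDegree,
      ‖artinHasseCoord p (tildeP p ζ P).coeff n‖ * ρ ^ n = 1) :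
    ∃ i ∈ Finset.Icc 1 P.natDegree, ‖(tildeE p ζ P).coeff i‖ * ρ ^ i = 1 := by
  classical
  have := isUltrametricDist_of_padic p L
  set D := P.natDegree with hD
  set a := artinHasseCoord p (tildeP p ζ P).coeff with ha
  have hex : ∃ n, n ∈ Finset.Icc 1 D ∧ ‖a n‖ * ρ ^ n = 1 := heq
  obtain ⟨hn, hna⟩ := Nat.find_spec hex
  have hmin : ∀ m < Nat.find hex, m ∈ Finset.Icc 1 D → ‖a m‖ * ρ ^ m < 1 := fun m hm hmem =>
    lt_of_le_of_ne (hle m hmem) fun h => Nat.find_min hex hm ⟨hmem, h⟩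
  set n := Nat.find hex with hndef
  obtain ⟨hn1, hnD⟩ := Finset.mem_Icc.1 hn
  refine ⟨n, hn, ?_⟩
  set T := (Finset.Icc 1 D).filter fun m => m < n with hT
  set T' := (Finset.Icc 1 D).filter fun m => ¬ m < n with hT'
  have hTmem : ∀ m ∈ T', 1 ≤ m ∧ n ≤ m := fun m hm =>
    ⟨(Finset.mem_Icc.1 (Finset.mem_filter.1 hm).1).1, not_lt.1 (Finset.mem_filter.1 hm).2⟩
  obtain ⟨r, hr, -, hler⟩ := exists_larger_radius (b := a) (S := T) (lt_add_one ρ)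
    fun m hm => hmin m (Finset.mem_filter.1 hm).2 (Finset.mem_filter.1 hm).1
  set F := ∏ m ∈ T, formalExp (dilate m (a m) (artinHasseLog p L)) with hF
  set R := ∑ m ∈ T', dilate m (a m) (artinHasseLog p L) with hR
  have h0 : ∀ m, 1 ≤ m → constantCoeff (dilate m (a m) (artinHasseLog p L)) = 0 := fun m hm =>
    constantCoeff_dilate (by omega) _ (constantCoeff_artinHasseLog p L)
  have hdlt : ∀ m, 1 ≤ m → ∀ i < m,
      PowerSeries.coeff i (dilate m (a m) (artinHasseLog p L)) = 0 := by
    intro m hm i hi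
    rcases Nat.eq_zero_or_pos i with rfl | hi0
    · rw [coeff_zero_eq_constantCoeff_apply, h0 m hm]
    · rw [coeff_dilate (by omega), if_neg fun h => absurd (Nat.le_of_dvd hi0 h) (by omega)]
  have hRlt : ∀ i < n, PowerSeries.coeff i R = 0 := fun i hi => by
    rw [hR, map_sum]
    exact Finset.sum_eq_zero fun m hm => hdlt m (hTmem m hm).1 i (hi.trans_le (hTmem m hm).2)
  have hRn : PowerSeries.coeff n R = a n := by
    rw [hR, map_sum, Finset.sum_eq_single n, coeff_dilate (by omega), if_pos dvd_rfl,
      Nat.div_self hn1, coeff_one_artinHasseLog, pow_one, mul_one]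
    · exact fun m hm hne => hdlt m (hTmem m hm).1 n (lt_of_le_of_ne (hTmem m hm).2 hne.symm)
    · exact fun h => absurd (Finset.mem_filter.2 ⟨hn, lt_irrefl n⟩) h
  have hprod : ∏ m ∈ Finset.Icc 1 D, formalExp (dilate m (a m) (artinHasseLog p L)) =
      F + (formalExp R - 1) * F := by
    rw [← Finset.prod_filter_mul_prod_filter_not (Finset.Icc 1 D) (fun m => m < n), ← hT, ← hT',
      ← formalExp_sum (s := T') fun m hm => h0 m (hTmem m hm).1]
    ring
  have hR0 : constantCoeff R = 0 := by
    rw [← coeff_zero_eq_constantCoeff_apply, hRlt 0 (by omega)]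
  have hF0 : constantCoeff F = 1 := by
    rw [hF, map_prod]
    exact Finset.prod_eq_one fun m hm => constantCoeff_formalExp
      (h0 m (Finset.mem_Icc.1 (Finset.mem_filter.1 hm).1).1)
  have hGlt : ∀ i < n, PowerSeries.coeff i (formalExp R - 1) = 0 := fun i hi => by
    have hcongr := coeff_formalExp_congr hR0 (R := 0) (map_zero _) (N := n - 1)
      (fun j hj => by rw [hRlt j (by omega), map_zero]) i (by omega)
    rw [map_sub, hcongr, formalExp_zero, sub_self]
  have hcoeff : (tildeE p ζ P).coeff n = a n + PowerSeries.coeff n F := by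
    rw [coeff_tildeE hnD, ← hD, ← ha, hprod, map_add, coeff_mul_of_coeff_lt_eq_zero hGlt, hF0,
      mul_one, map_sub, coeff_formalExp_of_coeff_eq_zero (by omega) hRlt, hRn,
      PowerSeries.coeff_one, if_neg (by omega), sub_zero, add_comm]
  have hFn : ‖PowerSeries.coeff n F‖ * ρ ^ n < 1 := by
    by_cases hzero : PowerSeries.coeff n F = 0
    · simp [hzero]
    · have hb : CoeffBound r 1 F := CoeffBound.prod (hρ.trans hr).le fun m hm =>
        coeffBound_formalExp_dilate p (hρ.trans hr).le
          (by have := (Finset.mem_Icc.1 (Finset.mem_filter.1 hm).1).1; omega) (hler m hm)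
      refine lt_of_lt_of_le ?_ (hb n)
      have : ρ ^ n < r ^ n := pow_lt_pow_left₀ hr hρ.le (by omega)
      have := norm_pos_iff.2 hzero
      gcongr
  rw [hcoeff, norm_add_eq_of_norm_lt, hna]
  rw [← hna] at hFn
  exact lt_of_mul_lt_mul_right hFn (by positivity)

end Exponential

/-! ### Cauchy-Hadamard radius and coefficient bounds -/

section ConvergenceRadius

variable {F : Type*} [NormedField F]

lemma inv_ofReal_rpow_natCast {r : ℝ} (hr : 0 < r) (i : ℕ) :
    (ENNReal.ofReal r)⁻¹ ^ (i : ℝ) = ENNReal.ofReal ((r ^ i)⁻¹) := by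
  rw [ENNReal.rpow_natCast, ← ENNReal.ofReal_inv_of_pos hr,
    ← ENNReal.ofReal_pow (inv_nonneg.2 hr.le), inv_pow]

lemma enorm_rpow_le_inv_iff {r : ℝ} (hr : 0 < r) {i : ℕ} (hi : 1 ≤ i) (x : F) :
    ‖x‖ₑ ^ (1 / (i : ℝ)) ≤ (ENNReal.ofReal r)⁻¹ ↔ ‖x‖ * r ^ i ≤ 1 := by
  have hi0 : (0 : ℝ) < i := by exact_mod_cast hi
  rw [one_div, ENNReal.rpow_inv_le_iff hi0, inv_ofReal_rpow_natCast hr, ← ofReal_norm,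
    ENNReal.ofReal_le_ofReal_iff (by positivity), ← one_div, le_div_iff₀ (by positivity)]

lemma enorm_rpow_eq_inv {r : ℝ} (hr : 0 < r) {i : ℕ} (hi : 1 ≤ i) {x : F}
    (hx : ‖x‖ * r ^ i = 1) : ‖x‖ₑ ^ (1 / (i : ℝ)) = (ENNReal.ofReal r)⁻¹ := by
  have hi0 : (0 : ℝ) < i := by exact_mod_cast hi
  refine le_antisymm ((enorm_rpow_le_inv_iff hr hi x).2 hx.le) ?_
  rw [one_div, ENNReal.le_rpow_inv_iff hi0, inv_ofReal_rpow_natCast hr, ← ofReal_norm,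
    eq_inv_of_mul_eq_one_left hx]

lemma ofReal_le_convergenceRadius {f : F⟦X⟧} {r C : ℝ} (hf : CoeffBound r C f) :
    ENNReal.ofReal r ≤ convergenceRadius f := by
  rcases le_or_gt r 0 with hr | hr
  · rw [ENNReal.ofReal_of_nonpos hr]
    exact zero_le
  refine le_of_forall_lt fun x hx => ?_
  obtain ⟨s, hxs, hsr⟩ := exists_between hx
  lift s to NNReal using hsr.ne_top
  have hs0 : (0 : ℝ) < s := by
    have : (0 : ℝ≥0∞) < s := zero_le.trans_lt hxs
    exact_mod_cast this
  have hsr' : (s : ℝ) < r := by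
    rw [← ENNReal.ofReal_coe_nnreal] at hsr
    exact (ENNReal.ofReal_lt_ofReal_iff hr).1 hsr
  refine hxs.trans_le ?_
  rw [convergenceRadius, ← ENNReal.ofReal_coe_nnreal, ENNReal.le_inv_iff_le_inv]
  refine Filter.limsup_le_of_le (by isBoundedDefault) ?_
  -- At a smaller radius `s`, the geometric factor `(s/r)^i` absorbs the constant `C`.
  have hlim : Filter.Tendsto (fun i : ℕ => C * ((s : ℝ) / r) ^ i) Filter.atTop (nhds 0) := by
    have := (tendsto_pow_atTop_nhds_zero_of_lt_one (r := (s : ℝ) / r) (by positivity)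
      ((div_lt_one hr).2 hsr')).const_mul C
    rwa [mul_zero] at this
  filter_upwards [hlim.eventually_le_const zero_lt_one, Filter.eventually_ge_atTop 1] with i hi hi1
  rw [enorm_rpow_le_inv_iff hs0 hi1]
  refine le_trans ?_ hi
  have : ‖PowerSeries.coeff i f‖ * (s : ℝ) ^ i =
      ‖PowerSeries.coeff i f‖ * r ^ i * ((s : ℝ) / r) ^ i := by
    rw [div_pow]
    field_simp
  rw [this]
  exact mul_le_mul_of_nonneg_right (hf i) (by positivity)

lemma exists_coeffBound_of_lt_convergenceRadius {f : F⟦X⟧} {r : ℝ} (hr : 0 < r)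
    (hf : ENNReal.ofReal r < convergenceRadius f) : ∃ C, CoeffBound r C f := by
  rw [convergenceRadius, ENNReal.lt_inv_iff_lt_inv] at hf
  obtain ⟨N, hN⟩ := Filter.eventually_atTop.1 (Filter.eventually_lt_of_limsup_lt hf)
  have hpos : ∀ i, 0 ≤ ‖PowerSeries.coeff i f‖ * r ^ i := fun i => by positivity
  refine ⟨1 + ∑ i ∈ Finset.range (N + 1), ‖PowerSeries.coeff i f‖ * r ^ i, fun i => ?_⟩
  by_cases hi : i < N + 1
  · have := Finset.single_le_sum (fun j _ => hpos j) (Finset.mem_range.2 hi)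
    linarith
  · have h1 := (enorm_rpow_le_inv_iff hr (by omega) _).1 (hN i (by omega)).le
    have h2 := Finset.sum_nonneg (s := Finset.range (N + 1)) fun j _ => hpos j
    linarith

lemma convergenceRadius_eq_ofReal {f : F⟦X⟧} {ρ C : ℝ} (hρ : 0 < ρ) (hf : CoeffBound ρ C f)
    (hf' : ∀ r C', ρ < r → ¬ CoeffBound r C' f) :
    convergenceRadius f = ENNReal.ofReal ρ := by
  refine le_antisymm (le_of_not_gt fun h => ?_) (ofReal_le_convergenceRadius hf)
  obtain ⟨s, hρs, hs⟩ := exists_between h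
  lift s to NNReal using hs.ne_top
  rw [← ENNReal.ofReal_coe_nnreal] at hρs hs
  have hs' : ρ < s := lt_of_not_ge fun h => absurd hρs (ENNReal.ofReal_le_ofReal h).not_gt
  obtain ⟨C', hC'⟩ := exists_coeffBound_of_lt_convergenceRadius (hρ.trans hs') hs
  exact hf' s C' hs' hC'

end ConvergenceRadius

/-! ### Formal solutions as constant multiples of `exp P` -/

section FormalSolution

lemma coeff_zero_zeroPrimitive {K : Type*} [Field K] (A : K[X]) : (zeroPrimitive A).coeff 0 = 0 := by
  rw [zeroPrimitive, Polynomial.finsetSum_coeff]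
  exact Finset.sum_eq_zero fun n _ => by rw [Polynomial.coeff_monomial, if_neg (by omega)]

variable {K : Type*} [Field K] [CharZero K] {A : K[X]}

lemma derivative_zeroPrimitive (A : K[X]) : (zeroPrimitive A).derivative = A := by
  conv_rhs => rw [A.as_sum_support]
  rw [zeroPrimitive, Polynomial.derivative_sum]
  refine Finset.sum_congr rfl fun n _ => ?_
  rw [Polynomial.derivative_monomial, Nat.add_sub_cancel]
  congr 1
  have : (n : K) + 1 ≠ 0 := by exact_mod_cast Nat.succ_ne_zero n
  push_cast
  field_simp

lemma zeroPrimitive_ne_zero (hA : A ≠ 0) : zeroPrimitive A ≠ 0 := fun h =>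
  hA (by rw [← derivative_zeroPrimitive A, h, Polynomial.derivative_zero])

/-- A solution of `y' = A y` is `y(0) exp P`. -/
lemma IsFormalSolution.map_eq {L : Type*} [Field L] [CharZero L] [Algebra K L] {y : K⟦X⟧}
    (hy : IsFormalSolution A y) :
    y.map (algebraMap K L) = PowerSeries.C (algebraMap K L (constantCoeff y)) *
      formalExp (((zeroPrimitive A).map (algebraMap K L) : L[X]) : L⟦X⟧) := by
  set P : L⟦X⟧ := (((zeroPrimitive A).map (algebraMap K L) : L[X]) : L⟦X⟧) with hP
  have hP0 : constantCoeff P = 0 := by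
    rw [← coeff_zero_eq_constantCoeff_apply, hP, Polynomial.coeff_coe, Polynomial.coeff_map,
      coeff_zero_zeroPrimitive, map_zero]
  have hdP : d⁄dX L P = (A : K⟦X⟧).map (algebraMap K L) := by
    rw [hP, PowerSeries.derivative_coe, Polynomial.derivative_map, derivative_zeroPrimitive]
    ext n
    simp
  refine eq_of_derivative_eq_mul (Q := d⁄dX L P) ?_ ?_ ?_
  · rw [derivative_powerSeries_map, hy, map_mul, hdP]
  · rw [Derivation.leibniz, derivative_formalExp hP0, PowerSeries.derivative_C, smul_zero, add_zero,
      smul_eq_mul]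
    ring
  · rw [map_mul, constantCoeff_formalExp hP0, mul_one, PowerSeries.constantCoeff_C,
      ← coeff_zero_eq_constantCoeff_apply, PowerSeries.coeff_map, coeff_zero_eq_constantCoeff_apply]

lemma IsFormalSolution.constantCoeff_ne_zero {y : K⟦X⟧} (hy : IsFormalSolution A y)
    (hy0 : y ≠ 0) : constantCoeff y ≠ 0 := fun h => hy0 <|
  eq_of_derivative_eq_mul (Q := (A : K⟦X⟧)) hy (by rw [map_zero, mul_zero]) (by rw [h, map_zero])

end FormalSolution

/-- The radius of convergence of a solution of `y' = A y` is the critical radius of the coordinates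
of `tildeP`. -/
lemma IsFormalSolution.convergenceRadius_eq {p : ℕ} [hp : Fact p.Prime] {K : Type*} [NormedField K]
    [CharZero K] {L : Type*} [NormedField L] [NormedAlgebra ℚ_[p] L] [NormedAlgebra K L]
    [CharZero L] {A : K[X]} {ζ : L}
    (hζ : IsPrimitiveRoot ζ (p ^ (floorLog p (zeroPrimitive A).natDegree 1 + 1)))
    {y : K⟦X⟧} (hy : IsFormalSolution A y) (hy0 : y ≠ 0) {ρ : ℝ} (hρ : 0 < ρ)
    (hle : ∀ n ∈ Finset.Icc 1 (zeroPrimitive A).natDegree,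
      ‖artinHasseCoord p (tildeP p ζ (zeroPrimitive A)).coeff n‖ * ρ ^ n ≤ 1)
    (heq : ∃ n ∈ Finset.Icc 1 (zeroPrimitive A).natDegree,
      ‖artinHasseCoord p (tildeP p ζ (zeroPrimitive A)).coeff n‖ * ρ ^ n = 1) :
    convergenceRadius y = ENNReal.ofReal ρ := by
  have hc := norm_pos_iff.2 (hy.constantCoeff_ne_zero hy0)
  have hnorm : ∀ i, ‖PowerSeries.coeff i y‖ = ‖constantCoeff y‖ * ‖PowerSeries.coeff i
      (formalExp (((zeroPrimitive A).map (algebraMap K L) : L[X]) : L⟦X⟧))‖ := by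
    intro i
    have h := congrArg (fun f => ‖PowerSeries.coeff i f‖) (hy.map_eq (L := L))
    simp only [PowerSeries.coeff_map, PowerSeries.coeff_C_mul, norm_mul, norm_algebraMap'] at h
    exact h
  refine convergenceRadius_eq_ofReal hρ (C := ‖constantCoeff y‖) (fun i => ?_) fun r C hr h => ?_
  · rw [hnorm, mul_assoc]
    exact mul_le_of_le_one_right hc.le
      (coeffBound_formalExp_map hζ (coeff_zero_zeroPrimitive A) hρ hle i)
  · refine not_coeffBound_formalExp_map hζ (coeff_zero_zeroPrimitive A) hρ hle heq hr
      (C := C / ‖constantCoeff y‖) fun i => ?_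
    have := h i
    rwa [hnorm, mul_assoc, mul_comm, ← le_div_iff₀ hc] at this

/-! ### Reading `ρ` off the coefficients of `ẽ` -/

section NewtonPolygon

variable {L : Type*} [NormedField L] {e : L[X]} {ρ : ℝ}

/-- The constant term keeps the Gauss norm at least `1`, with equality up to `ρ`; beyond `ρ` the
index of equality pushes it above `1`. -/
lemma isEndOfFirstSegment_dualNewtonPolygon (hρ : 0 < ρ) (h0 : e.coeff 0 = 1)
    (hle : ∀ i, ‖e.coeff i‖ * ρ ^ i ≤ 1) (heq : ∃ i, 1 ≤ i ∧ ‖e.coeff i‖ * ρ ^ i = 1) :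
    IsEndOfFirstSegment (dualNewtonPolygon e) 0 (Real.log ρ) := by
  set v := NormedField.toAbsoluteValue L with hv
  have hvnorm : ∀ x, v x = ‖x‖ := fun x => rfl
  have hge : ∀ c, 0 ≤ c → 1 ≤ e.gaussNorm v c := fun c hc => by
    have := e.le_gaussNorm v hc 0
    simpa [hvnorm, h0] using this
  have hone : ∀ s ≤ Real.log ρ, dualNewtonPolygon e s = 0 := by
    intro s hs
    rw [dualNewtonPolygon, ← hv, le_antisymm _ (hge _ (Real.exp_pos s).le), Real.log_one]
    obtain ⟨i, hi⟩ := e.exists_eq_gaussNorm v (Real.exp s)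
    rw [hi, hvnorm]
    refine le_trans ?_ (hle i)
    have : Real.exp s ≤ ρ := (Real.le_log_iff_exp_le hρ).1 hs
    gcongr
  constructor
  · intro s hs
    rw [hone s hs, hone _ le_rfl]
    ring
  · intro u hu
    by_contra! hlt
    have h1 := hu (Real.log ρ) hlt.le
    rw [hone _ le_rfl, zero_mul, add_zero] at h1
    obtain ⟨i, hi, hei⟩ := heq
    have hρu : ρ < Real.exp u := (Real.log_lt_iff_lt_exp hρ).1 hlt
    have he0 : 0 < ‖e.coeff i‖ := by
      refine (norm_nonneg _).lt_of_ne fun h => ?_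
      rw [← h, zero_mul] at hei
      exact zero_ne_one hei
    have h2 : 1 < e.gaussNorm v (Real.exp u) := by
      refine lt_of_lt_of_le ?_ (e.le_gaussNorm v (Real.exp_pos u).le i)
      rw [hvnorm, ← hei]
      have : ρ ^ i < Real.exp u ^ i := pow_lt_pow_left₀ hρu hρ.le (by omega)
      gcongr
    exact (Real.log_pos h2).ne h1

/-- Each term is the logarithm of `‖e_i‖^(1/i)`, so vanishing coefficients contribute `-∞` without a
separate case. -/
lemma neg_log_eq_sup (hρ : 0 < ρ) {D : ℕ} (hle : ∀ i, ‖e.coeff i‖ * ρ ^ i ≤ 1)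
    (heq : ∃ i ∈ Finset.Icc 1 D, ‖e.coeff i‖ * ρ ^ i = 1) :
    -ENNReal.log (ENNReal.ofReal ρ) = (Finset.Icc 1 D).sup fun i : ℕ =>
      ((1 / (i : ℝ) : ℝ) : EReal) * ENNReal.log ‖e.coeff i‖ₑ := by
  simp only [← ENNReal.log_rpow, ← ENNReal.log_inv]
  refine le_antisymm ?_ (Finset.sup_le fun i hi => ?_)
  · obtain ⟨i, hi, h⟩ := heq
    rw [← enorm_rpow_eq_inv hρ (Finset.mem_Icc.1 hi).1 h]
    exact Finset.le_sup (f := fun i : ℕ => ENNReal.log (‖e.coeff i‖ₑ ^ (1 / (i : ℝ)))) hi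
  · exact ENNReal.log_le_log ((enorm_rpow_le_inv_iff hρ (Finset.mem_Icc.1 hi).1 _).2 (hle i))

end NewtonPolygon

/-! ### Absolute values of the roots -/

section Roots

variable {F : Type*} [NormedField F] [IsUltrametricDist F]

/-- The Gauss norm at `r` of `X - a` with `|a| ≥ r` is the norm of its constant term, and bounds of
this kind multiply. -/
lemma coeffBound_multiset_prod_X_sub_C {r : ℝ} (hr : 0 ≤ r) (s : Multiset F)
    (hs : ∀ x ∈ s, r ≤ ‖x‖) :
    CoeffBound r ‖((s.map fun x => Polynomial.X - Polynomial.C x).prod : F[X]).coeff 0‖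
      (((s.map fun x => Polynomial.X - Polynomial.C x).prod : F[X]) : F⟦X⟧) := by
  induction s using Multiset.induction_on with
  | empty => simpa using coeffBound_one
  | cons a s ih =>
    rw [Multiset.map_cons, Multiset.prod_cons, Polynomial.mul_coeff_zero, norm_mul,
      Polynomial.coe_mul]
    refine CoeffBound.mul hr (norm_nonneg _) (norm_nonneg _) (fun i => ?_)
      (ih fun x hx => hs x (Multiset.mem_cons_of_mem hx))
    have ha := hs a (Multiset.mem_cons_self a s)
    rw [Polynomial.coeff_coe]
    match i with
    | 0 => simp
    | 1 => simpa [Polynomial.coeff_X, Polynomial.coeff_C] using ha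
    | i + 2 => simp [Polynomial.coeff_X, Polynomial.coeff_C]

/-- The smallest absolute value of a root of a split polynomial `e` with constant term `1` is the
radius `ρ` at which `max_{i ≥ 1} ‖e_i‖ ρ ^ i = 1`. -/
lemma isLeast_norm_roots {e : F[X]} {ρ : ℝ} (hρ : 0 < ρ) (h0 : e.coeff 0 = 1)
    (hle : ∀ i, ‖e.coeff i‖ * ρ ^ i ≤ 1) (heq : ∃ i, 1 ≤ i ∧ ‖e.coeff i‖ * ρ ^ i = 1)
    (hsplit : e.Splits) : IsLeast {r : ℝ | ∃ x : F, e.eval x = 0 ∧ r = ‖x‖} ρ := by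
  classical
  have hlow : ∀ x : F, e.eval x = 0 → ρ ≤ ‖x‖ := by
    intro x hx
    by_contra! hlt
    -- For `‖x‖ < ρ` the constant term `1` strictly dominates all others, so `e` cannot vanish at
    -- `x`.
    rw [Polynomial.eval_eq_sum_range, Finset.sum_range_succ', pow_zero, mul_one, h0] at hx
    have h1 : ‖∑ i ∈ Finset.range e.natDegree, e.coeff (i + 1) * x ^ (i + 1)‖ * 1 < 1 := by
      refine norm_sum_mul_pow_lt zero_le_one zero_lt_one fun i _ => ?_
      rw [mul_one, norm_mul, norm_pow]
      by_cases hi : e.coeff (i + 1) = 0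
      · simp [hi]
      · refine lt_of_lt_of_le ?_ (hle (i + 1))
        have : ‖x‖ ^ (i + 1) < ρ ^ (i + 1) :=
          pow_lt_pow_left₀ hlt (norm_nonneg _) (Nat.succ_ne_zero i)
        have := norm_pos_iff.2 hi
        gcongr
    rw [mul_one, eq_neg_of_add_eq_zero_left hx, norm_neg, norm_one] at h1
    exact lt_irrefl _ h1
  obtain ⟨i, hi, hei⟩ := heq
  have he : e ≠ 0 := fun h => by simp [h] at h0
  have hei0 : e.coeff i ≠ 0 := by
    intro h
    rw [h, norm_zero, zero_mul] at hei
    exact zero_ne_one hei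
  have hne : e.roots.toFinset.Nonempty := by
    have hdeg : 1 ≤ e.natDegree := hi.trans (Polynomial.le_natDegree_of_ne_zero hei0)
    rw [hsplit.natDegree_eq_card_roots] at hdeg
    obtain ⟨x, hx⟩ := Multiset.card_pos_iff_exists_mem.1 hdeg
    exact ⟨x, Multiset.mem_toFinset.2 hx⟩
  obtain ⟨x, hx, hmin⟩ := e.roots.toFinset.exists_min_image (fun x => ‖x‖) hne
  have hx0 : e.eval x = 0 := (Polynomial.mem_roots he).1 (Multiset.mem_toFinset.1 hx)
  have hxρ : ρ = ‖x‖ := by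
    -- If the smallest root norm exceeded `ρ`, the factorization would bound `‖e_i‖ ‖x‖^i` by `‖e_0‖
    -- = 1`, against `‖e_i‖ ρ^i = 1`.
    refine le_antisymm (hlow x hx0) (le_of_not_gt fun hlt => ?_)
    have hb := coeffBound_multiset_prod_X_sub_C (norm_nonneg x) e.roots
      fun z hz => hmin z (Multiset.mem_toFinset.2 hz)
    have hfac := hsplit.eq_prod_roots
    set q := (e.roots.map fun x => Polynomial.X - Polynomial.C x).prod with hq
    have hlc : ‖e.leadingCoeff‖ * ‖q.coeff 0‖ = 1 := by
      have := congrArg (fun f => ‖Polynomial.coeff f 0‖) hfac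
      simp only [Polynomial.coeff_C_mul, norm_mul, h0, norm_one] at this
      exact this.symm
    have h1 := hb i
    rw [Polynomial.coeff_coe] at h1
    have h2 : ‖e.coeff i‖ * ‖x‖ ^ i ≤ 1 := by
      rw [hfac, Polynomial.coeff_C_mul, norm_mul, ← hlc, mul_assoc]
      exact mul_le_mul_of_nonneg_left h1 (norm_nonneg _)
    have h3 : ρ ^ i < ‖x‖ ^ i := pow_lt_pow_left₀ hlt hρ.le (by omega)
    have h4 := mul_lt_mul_of_pos_left h3 (norm_pos_iff.2 hei0)
    linarith
  refine ⟨⟨x, hx0, hxρ⟩, ?_⟩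
  rintro _ ⟨z, hz, rfl⟩
  exact hlow z hz

end Roots

theorem mainTheorem6 (p : ℕ) [Fact p.Prime]
    {K : Type*} [NormedField K] [NormedAlgebra ℚ_[p] K]
    {L : Type*} [NormedField L] [NormedAlgebra K L] [CharZero L]
    (A : K[X]) (hA : A ≠ 0)
    (ζ : L) (hζ : IsPrimitiveRoot ζ (p ^ (floorLog p (zeroPrimitive A).natDegree 1 + 1)))
    (y : K⟦X⟧) (hy : IsFormalSolution A y) (hy0 : y ≠ 0) :
    (0 < convergenceRadius y ∧ convergenceRadius y < ⊤) ∧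
    IsEndOfFirstSegment (dualNewtonPolygon (tildeE p ζ (zeroPrimitive A))) 0
      (Real.log (convergenceRadius y).toReal) ∧
    (∀ (Ω : Type*) [NormedField Ω] [NormedAlgebra L Ω],
      ((tildeE p ζ (zeroPrimitive A)).map (algebraMap L Ω)).Splits →
      IsLeast {r : ℝ | ∃ x : Ω, aeval x (tildeE p ζ (zeroPrimitive A)) = 0 ∧ r = ‖x‖}
        (convergenceRadius y).toReal) ∧
    -ENNReal.log (convergenceRadius y) =
      (Finset.Icc 1 (zeroPrimitive A).natDegree).sup fun i : ℕ =>
        ((1 / (i : ℝ) : ℝ) : EReal) *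
          ENNReal.log ‖(tildeE p ζ (zeroPrimitive A)).coeff i‖ₑ := by
  have hp : p.Prime := Fact.out
  have : CharZero K := charZero_of_injective_algebraMap (algebraMap ℚ_[p] K).injective
  let _ : NormedAlgebra ℚ_[p] L := NormedAlgebra.restrictScalars ℚ_[p] K L
  obtain ⟨ρ, hρ, hle, heq⟩ := exists_critical_radius (exists_artinHasseCoord_ne_zero hp hζ
    (coeff_zero_zeroPrimitive A) (zeroPrimitive_ne_zero hA))
  have hrad := hy.convergenceRadius_eq hζ hy0 hρ hle heq
  have hle' := norm_coeff_tildeE_le hρ hle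
  obtain ⟨i, hi, hei⟩ := exists_norm_coeff_tildeE_eq hρ hle heq
  have h0 := coeff_zero_tildeE p ζ (zeroPrimitive A)
  have heq' : ∃ i, 1 ≤ i ∧ ‖(tildeE p ζ (zeroPrimitive A)).coeff i‖ * ρ ^ i = 1 :=
    ⟨i, (Finset.mem_Icc.1 hi).1, hei⟩
  rw [hrad, ENNReal.toReal_ofReal hρ.le]
  refine ⟨⟨ENNReal.ofReal_pos.2 hρ, ENNReal.ofReal_lt_top⟩,
    isEndOfFirstSegment_dualNewtonPolygon hρ h0 hle' heq', ?_, neg_log_eq_sup hρ hle' ⟨i, hi, hei⟩⟩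
  intro Ω _ _ hsplit
  let _ : NormedAlgebra ℚ_[p] Ω := NormedAlgebra.restrictScalars ℚ_[p] L Ω
  have := isUltrametricDist_of_padic p Ω
  have h := isLeast_norm_roots (e := (tildeE p ζ (zeroPrimitive A)).map (algebraMap L Ω)) hρ
    (by rw [Polynomial.coeff_map, h0, map_one])
    (fun j => by rw [Polynomial.coeff_map, norm_algebraMap']; exact hle' j)
    (by simpa only [Polynomial.coeff_map, norm_algebraMap'] using heq') hsplit
  simpa only [Polynomial.eval_map_algebraMap] using h
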